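/- A \emph{black box search tree} is a finite rooted tree $T$ in which no node has exactly one child, the children of every node are linearly ordered, and every leaf $l$ has a colour $\mathrm{Col}(l)\in\mathbb N$; $|T|$ denotes its number of nodes. The inputs are pairs $(T_1,T_2)$ of such trees satisfying \emph{complete isomorphism invariance}: for all $i,j\in\{1,2\}$, whenever leaves $l$ of $T_i$ and $l'$ of $T_j$ have the same colour, there is a bijection $V(T_i)\to V(T_j)$ that preserves the child relation in both directions and the colours of leaves, and maps $l$ to $l'$. A randomized exploration algorithm accesses the trees only through an oracle. At the beginning only the two roots are explored. The algorithm may request the $k$-th child of an explored node, which thereby becomes explored; of every explored node it learns the number of children and, if the node is a leaf, the colour. It may also draw uniformly random elements of finite sets. The \emph{cost} of a run is the number of distinct nodes explored by oracle accesses (the roots are explored at no cost). \textbf{Theorem.} There are an absolute constant $C>0$ and a randomized exploration algorithm that receives a number $\varepsilon\in(0,1]$ as input such that, for every $\varepsilon\in(0,1]$ and every input pair $(T_1,T_2)$ as above, the algorithm halts with probability $1$ and 1. if there are leaves $l_1$ of $T_1$ and $l_2$ of $T_2$ with $\mathrm{Col}(l_1)=\mathrm{Col}(l_2)$, then with probability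 at least $1-\varepsilon$ the algorithm outputs such a pair of leaves; 2. (one-sided error) with probability $1$ it never outputs a pair that is not such a pair, and if there are no such leaves, then it outputs $\bot$ with probability $1$; 3. its expected cost is at most $$C\cdot\left\lceil\log_2\tfrac1\varepsilon\right\rceil\cdot\log_2\!\left(\min\{\sqrt{|T_1|},\sqrt{|T_2|}\}\right)\cdot\min\{\sqrt{|T_1|},\sqrt{|T_2|}\}.$$ -/

import Mathlib

open scoped ENNReal

/-! ### Black box search trees -/

/-- A finite rooted tree with naturally coloured leaves and ordered children in which every inner
node has at least two children: `node k child` has the `k + 2` children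
`child 0, …, child (k + 1)`. -/
inductive SearchTree : Type
  | leaf (color : ℕ) : SearchTree
  | node (k : ℕ) (child : Fin (k + 2) → SearchTree) : SearchTree

/-- What is learned about a node when it is explored: `Sum.inl c` says that it is a leaf of
colour `c`, and `Sum.inr d` says that it is an inner node with `d` children. -/
abbrev NodeInfo : Type := ℕ ⊕ ℕ

namespace SearchTree

/-- The number `|T|` of nodes. -/
def size : SearchTree → ℕ
  | leaf _ => 1
  | node _ child => 1 + ∑ i, (child i).size

/-- The subtree at an address. Nodes are addressed by the sequence of (zero-based) child indices
on the path from the root; the value is `none` if there is no node with this address. -/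
def subtreeAt : SearchTree → List ℕ → Option SearchTree
  | T, [] => some T
  | leaf _, _ :: _ => none
  | node k child, i :: p => if h : i < k + 2 then (child ⟨i, h⟩).subtreeAt p else none

/-- The information about the root of a tree. -/
def rootInfo : SearchTree → NodeInfo
  | leaf c => Sum.inl c
  | node k _ => Sum.inr (k + 2)

/-- The information about the node with address `p`, if there is such a node. -/
def info (T : SearchTree) (p : List ℕ) : Option NodeInfo := (T.subtreeAt p).map rootInfo

/-- The node set `V(T)`, as the set of all addresses of nodes. -/
def Vertex (T : SearchTree) : Type := {p : List ℕ // (T.info p).isSome}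

/-- `p` is the address of a leaf of `T` of colour `c`. -/
def IsLeafOfColor (T : SearchTree) (p : List ℕ) (c : ℕ) : Prop := T.info p = some (Sum.inl c)

/-- `v` is a child of `u`. -/
def IsChild {T : SearchTree} (v u : T.Vertex) : Prop := ∃ i : ℕ, v.1 = u.1 ++ [i]

/-- Colour-preserving isomorphisms of rooted trees (the order of the children is ignored). -/
def IsColorIso {T T' : SearchTree} (φ : T.Vertex ≃ T'.Vertex) : Prop :=
  (∀ v u : T.Vertex, IsChild v u ↔ IsChild (φ v) (φ u)) ∧
    ∀ (l : T.Vertex) (c : ℕ), T.IsLeafOfColor l.1 c → T'.IsLeafOfColor (φ l).1 c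

/-- Complete isomorphism invariance of the pair `(T, T')`: whenever a leaf of `T` and a leaf of
`T'` have the same colour, some colour-preserving isomorphism maps the first to the second. -/
def CompleteInvariance (T T' : SearchTree) : Prop :=
  ∀ (l : T.Vertex) (l' : T'.Vertex) (c : ℕ), T.IsLeafOfColor l.1 c → T'.IsLeafOfColor l'.1 c →
    ∃ φ : T.Vertex ≃ T'.Vertex, IsColorIso φ ∧ φ l = l'

end SearchTree

/-! ### Isomorphism exploration -/

/-- An answer to the isomorphism exploration problem: the addresses of a leaf of the first and of a
leaf of the second tree, or `none` for `⊥`. -/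
abbrev Answer : Type := Option (List ℕ × List ℕ)

/-- `p` and `q` are equally coloured leaves of the first and of the second tree, respectively. -/
def IsMatch (T : Fin 2 → SearchTree) (p q : List ℕ) : Prop :=
  ∃ c : ℕ, (T 0).IsLeafOfColor p c ∧ (T 1).IsLeafOfColor q c

/-- The correct answers: a matching pair of leaves, and `⊥` if there is no such pair. -/
def IsSolution (T : Fin 2 → SearchTree) : Answer → Prop
  | some (p, q) => IsMatch T p q
  | none => ¬ ∃ p q : List ℕ, IsMatch T p q

/-! ### Randomized exploration algorithms -/

/-- The actions of an algorithm:
* `Sum.inl (i, p)` requests the node with address `p` of the tree `i`;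
* `Sum.inr (Sum.inl m)` draws a uniformly random element of `{0, …, m}`;
* `Sum.inr (Sum.inr r)` halts with the answer `r`. -/
abbrev ExplorationAction : Type := (Fin 2 × List ℕ) ⊕ ℕ ⊕ Answer

/-- A randomized exploration algorithm, as a machine with computable transitions that accesses the
two trees only through requests. -/
structure ExplorationAlgorithm : Type 1 where
  /-- The possible contents of the memory. -/
  State : Type
  [primcodable : Primcodable State]
  /-- The initial content of the memory, on input of the error bound. -/
  start : ℝ → State
  /-- The next action. -/
  act : State → ExplorationAction
  /-- The new content of the memory after a request and the reply to it. -/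
  afterRequest : State → Option NodeInfo → State
  /-- The new content of the memory after a random draw and its outcome. -/
  afterDraw : State → ℕ → State
  computable_act : Computable act
  computable_afterRequest : Computable₂ afterRequest
  computable_afterDraw : Computable₂ afterDraw

namespace ExplorationAlgorithm

/-- The content of the memory together with the set of explored nodes of both trees. -/
structure Config (A : ExplorationAlgorithm) where
  mem : A.State
  explored : Finset (Fin 2 × List ℕ)

variable (A : ExplorationAlgorithm) (T : Fin 2 → SearchTree)

/-- At the beginning exactly the two roots are explored. -/
def initial (ε : ℝ) : A.Config := ⟨A.start ε, {(0, []), (1, [])}⟩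

/-- The oracle. A request is granted if the parent of the requested node is explored, and if the
node exists; the node then becomes explored. (As `[].dropLast = []`, the information about a root
can always be requested.) A request that is not granted has no effect and is replied to by `none`. -/
def request (c : A.Config) (i : Fin 2) (p : List ℕ) : A.Config :=
  if (i, p.dropLast) ∈ c.explored ∧ ((T i).info p).isSome then
    ⟨A.afterRequest c.mem ((T i).info p), insert (i, p) c.explored⟩
  else ⟨A.afterRequest c.mem none, c.explored⟩

/-- One step of the computation. A configuration in which the algorithm halts is kept forever. -/
noncomputable def step (c : A.Config) : PMF A.Config :=
  match A.act c.mem with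
  | Sum.inl (i, p) => PMF.pure (A.request T c i p)
  | Sum.inr (Sum.inl m) =>
      (PMF.uniformOfFintype (Fin (m + 1))).map fun k => ⟨A.afterDraw c.mem k, c.explored⟩
  | Sum.inr (Sum.inr _) => PMF.pure c

/-- The distribution of the configuration after `n` steps on the input `T` and `ε`. -/
noncomputable def run (ε : ℝ) : ℕ → PMF A.Config
  | 0 => PMF.pure (A.initial ε)
  | n + 1 => (run ε n).bind (A.step T)

/-- The probability that the algorithm halts with an answer in `S`: the increasing limit of the
probabilities that it does so within `n` steps. -/
noncomputable def answerProb (ε : ℝ) (S : Set Answer) : ℝ≥0∞ :=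
  ⨆ n : ℕ, (A.run T ε n).toOuterMeasure {c | ∃ r ∈ S, A.act c.mem = Sum.inr (Sum.inr r)}

/-- The cost: the number of nodes that have been explored by oracle accesses, that is, of all
explored nodes other than the two roots. Each node is counted once. -/
def Config.cost {A : ExplorationAlgorithm} (c : A.Config) : ℕ :=
  (c.explored.filter fun x => x.2 ≠ []).card

/-- The expected cost of the whole computation: the increasing limit of the expected costs of the
first `n` steps. -/
noncomputable def expectedCost (ε : ℝ) : ℝ≥0∞ :=
  ⨆ n : ℕ, ∑' c : A.Config, A.run T ε n c * (c.cost : ℝ≥0∞)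

end ExplorationAlgorithm

/-! ### The machine -/

/-! The algorithm makes `⌈log₂ (1/ε)⌉` runs of a birthday-type collision search. A sample picks one
of the two trees by a fair coin and walks at random from its root; a leaf that is reached is stored
with its colour. A run ends at the first repeated colour: with leaves of different trees it gives a
correct answer, with leaves of the same tree the run fails. Since sizes are unknown, walks are
truncated at a length that grows logarithmically with the number of samples.

Failure. If a matching pair exists, the trees are isomorphic, so walks in both have the same colour
distribution (`IsColorIso.walkMean_eq`). Given the colour of a sample, the coin is still fair, so
the first collision is a cross collision with probability 1/2, and all runs fail with probability at
most `(1/2) ^ ⌈log₂ (1/ε)⌉ ≤ ε` (`isPotential_failure`). Answers are compared by stored colours, so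
a wrong pair is never given.

Cost. Fix either tree `S`, and let `m` be about `√|S|`. After a constant times `m` samples, a walk
in `S` reaches a leaf with probability at least 1/2, because every inner node branches
(`walkMean_none_le`). From then on let `a` be the probability that a walk in `S` hits a seen colour.
A sample from `S` decreases `1 / (a + 1/(4m))` by a constant in expectation
(`one_div_twelve_le_drift`): if `a` is large, by a collision, which brings the value to 0; if `a` is
small, by enlarging `a`. The initial value is `4m`, so `O(m)` samples of `O(log m)` steps suffice.
Samples from the other tree never increase the value, and no relation between the trees is used, so
the smaller tree may be taken as `S` (`isPotential_cost`).

Both arguments are potential (supermartingale) arguments. `IsPotential` reduces them to one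
inequality per sample and `IsPotential.runMean_le` transfers it to the steps of the machine. The
cost potential also bounds the expected number of steps, hence the algorithm halts almost surely. -/

namespace CollisionSearch

/-- A leaf that has been seen: its colour, the tree that contains it, and its address. -/
abbrev SeenLeaf : Type := ℕ × Fin 2 × List ℕ

/-- The number of further runs, the number of samples of the current run so far, and the leaves
that the current run has seen. -/
abbrev Progress : Type := ℕ × ℕ × List SeenLeaf

/-- The current node of a random walk and the number of steps that it may still make. -/
abbrev Walk : Type := (Fin 2 × List ℕ) × ℕ

/-- The contents of the memory. -/
inductive Memory : Type
  | halt (a : Answer)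
  | check (r : ℕ) (o : Option NodeInfo)
  | toss (x : Progress)
  | visit (x : Progress) (w : Walk)
  | branch (x : Progress) (w : Walk) (d : ℕ)

/-! ### Primitive recursion by cases, and the coding of the memory. -/

theorem primrec₂_sum {α β γ σ : Type*} [Primcodable α] [Primcodable β] [Primcodable γ]
    [Primcodable σ] {F : α → β ⊕ γ → σ} (inl : Primrec₂ fun a b => F a (.inl b))
    (inr : Primrec₂ fun a c => F a (.inr c)) : Primrec₂ F := by
  have h : Primrec fun z : α × (β ⊕ γ) => F z.1 z.2 :=
    (Primrec.sumCasesOn Primrec.snd (inl.comp (Primrec.fst.comp Primrec.fst) Primrec.snd).to₂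
      (inr.comp (Primrec.fst.comp Primrec.fst) Primrec.snd).to₂).of_eq <| by
      rintro ⟨a, _ | _⟩ <;> rfl
  exact h

theorem primrec₂_option {α β σ : Type*} [Primcodable α] [Primcodable β] [Primcodable σ]
    {F : α → Option β → σ} (none : Primrec fun a => F a none)
    (some : Primrec₂ fun a b => F a (some b)) : Primrec₂ F := by
  have h : Primrec fun z : α × Option β => F z.1 z.2 :=
    (Primrec.option_casesOn Primrec.snd (none.comp Primrec.fst)
      (some.comp (Primrec.fst.comp Primrec.fst) Primrec.snd).to₂).of_eq <| by
      rintro ⟨a, _ | _⟩ <;> rfl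
  exact h

namespace Memory

abbrev Code : Type :=
  Answer ⊕ (ℕ × Option NodeInfo) ⊕ Progress ⊕ (Progress × Walk) ⊕ (Progress × Walk × ℕ)

def equivCode : Memory ≃ Code where
  toFun
    | halt a => .inl a
    | check r o => .inr (.inl (r, o))
    | toss x => .inr (.inr (.inl x))
    | visit x w => .inr (.inr (.inr (.inl (x, w))))
    | branch x w d => .inr (.inr (.inr (.inr (x, w, d))))
  invFun
    | .inl a => halt a
    | .inr (.inl (r, o)) => check r o
    | .inr (.inr (.inl x)) => toss x
    | .inr (.inr (.inr (.inl (x, w)))) => visit x w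
    | .inr (.inr (.inr (.inr (x, w, d)))) => branch x w d
  left_inv m := by cases m <;> rfl
  right_inv c := by rcases c with _ | _ | _ | _ | _ <;> rfl

instance : Primcodable Memory := Primcodable.ofEquiv _ equivCode

variable {α σ : Type*} [Primcodable α] [Primcodable σ]

theorem primrec_equivCode : Primrec equivCode := Primrec.of_equiv

theorem primrec_equivCode_symm : Primrec equivCode.symm := Primrec.of_equiv_symm

theorem primrec₂_of_cases {F : α → Memory → σ}
    (halt : Primrec₂ fun a x => F a (.halt x))
    (check : Primrec₂ fun a (x : ℕ × Option NodeInfo) => F a (.check x.1 x.2))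
    (toss : Primrec₂ fun a x => F a (.toss x))
    (visit : Primrec₂ fun a (x : Progress × Walk) => F a (.visit x.1 x.2))
    (branch : Primrec₂ fun a (x : Progress × Walk × ℕ) => F a (.branch x.1 x.2.1 x.2.2)) :
    Primrec₂ F := by
  have h : Primrec₂ fun a c => F a (equivCode.symm c) :=
    primrec₂_sum halt (primrec₂_sum check (primrec₂_sum toss (primrec₂_sum visit branch)))
  exact (h.comp Primrec.fst (primrec_equivCode.comp Primrec.snd)).of_eq fun z => by simp

theorem primrec_halt : Primrec halt :=
  primrec_equivCode_symm.comp Primrec.sumInl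

theorem primrec_check : Primrec₂ check :=
  primrec_equivCode_symm.comp (Primrec.sumInr.comp Primrec.sumInl)

theorem primrec_toss : Primrec toss :=
  primrec_equivCode_symm.comp (Primrec.sumInr.comp (Primrec.sumInr.comp Primrec.sumInl))

theorem primrec_visit : Primrec₂ visit :=
  primrec_equivCode_symm.comp
    (Primrec.sumInr.comp (Primrec.sumInr.comp (Primrec.sumInr.comp Primrec.sumInl)))

theorem primrec_branch : Primrec fun z : Progress × Walk × ℕ => branch z.1 z.2.1 z.2.2 :=
  primrec_equivCode_symm.comp
    (Primrec.sumInr.comp (Primrec.sumInr.comp (Primrec.sumInr.comp Primrec.sumInr)))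

end Memory

/-- The number of binary digits of `t`. -/
def bitLength (t : ℕ) : ℕ := t.rec 0 fun t l => if 2 ^ l ≤ t + 1 then l + 1 else l

/-- The bound on the lengths of the random walks after `t` samples. -/
def walkBound (t : ℕ) : ℕ := bitLength t + bitLength t

/-- The tree and the address of a seen leaf of colour `c`. -/
def lookup (L : List SeenLeaf) (c : ℕ) : Option (Fin 2 × List ℕ) :=
  L.foldr (fun e o => if e.1 = c then some e.2 else o) none

/-- The end of an unsuccessful run. -/
def endRun (r : ℕ) : Memory :=
  r.casesOn (Memory.halt none) fun r => Memory.toss (r, 0, [])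

/-- The pair of the addresses of a leaf of the tree `s` and a leaf of the other tree. -/
def crossAnswer (s : Fin 2) (p q : List ℕ) : Answer := if s = 0 then some (p, q) else some (q, p)

/-- A random walk has reached a leaf of colour `c` at the address `v.2` of the tree `v.1`. -/
def reachLeaf (x : Progress) (v : Fin 2 × List ℕ) (c : ℕ) : Memory :=
  (lookup x.2.2 c).casesOn (Memory.toss (x.1, x.2.1 + 1, (c, v) :: x.2.2)) fun u =>
    if u.1 = v.1 then endRun x.1 else Memory.halt (crossAnswer v.1 v.2 u.2)

/-- The random walk `w` has reached an inner node with `d` children. -/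
def reachNode (x : Progress) (w : Walk) (d : ℕ) : Memory :=
  w.2.casesOn (Memory.toss (x.1, x.2.1 + 1, x.2.2)) fun f => Memory.branch x (w.1, f) d

/-- Both roots are known. -/
def checkRoots (r : ℕ) (i j : NodeInfo) : Memory :=
  i.casesOn
    (fun c => j.casesOn
      (fun c' => if c = c' then Memory.halt (some ([], [])) else Memory.halt none)
      fun _ => Memory.halt none)
    (fun _ => j.casesOn (fun _ => Memory.halt none) fun _ => Memory.toss (r, 0, []))

def action : Memory → ExplorationAction
  | .halt a => .inr (.inr a)
  | .check _ o => .inl (o.elim 0 fun _ => 1, [])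
  | .toss _ => .inr (.inl 1)
  | .visit _ w => .inl w.1
  | .branch _ _ d => .inr (.inl d.pred)

/-- The values `.halt none` for refused requests and for states that make no request are
placeholders; `Consistent` shows that no request is refused. -/
def onReply (r : Option NodeInfo) : Memory → Memory
  | .halt _ => .halt none
  | .check n o => r.casesOn (.halt none) fun j =>
      o.casesOn (.check n (some j)) fun i => checkRoots n i j
  | .toss _ => .halt none
  | .visit x w => r.casesOn (.halt none) fun i =>
      i.casesOn (fun c => reachLeaf x w.1 c) fun d => reachNode x w d
  | .branch _ _ _ => .halt none

def onDraw (k : ℕ) : Memory → Memory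
  | .halt _ => .halt none
  | .check _ _ => .halt none
  -- The bound is 0 for the first sample of a run, which therefore stops at the root.
  | .toss x => .visit x ((if k = 0 then 0 else 1, []), walkBound x.2.1)
  | .visit _ _ => .halt none
  | .branch x w _ => .visit x ((w.1.1, w.1.2 ++ [k]), w.2)

/-! ### Computability of the transitions. -/

section Primrec

open Primrec

theorem primrec_bitLength : Primrec bitLength := by
  have pow : Primrec₂ ((· ^ ·) : ℕ → ℕ → ℕ) := Primrec₂.unpaired'.1 Nat.Primrec.pow
  refine nat_rec₁ 0 (f := fun t l => if 2 ^ l ≤ t + 1 then l + 1 else l) ?_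
  exact (Primrec.ite (nat_le.comp (pow.comp (Primrec.const 2) snd) (succ.comp fst))
    (succ.comp snd) snd).to₂

theorem primrec_walkBound : Primrec walkBound :=
  nat_add.comp primrec_bitLength primrec_bitLength

theorem primrec_lookup : Primrec₂ lookup := by
  refine (list_foldr (f := fun z : List SeenLeaf × ℕ => z.1) (g := fun _ => none)
    (h := fun z e => if e.1.1 = z.2 then some e.1.2 else e.2) fst (Primrec.const none) ?_)
  exact (Primrec.ite (Primrec.eq.comp (fst.comp (fst.comp snd)) (snd.comp fst))
    (option_some.comp (snd.comp (fst.comp snd))) (snd.comp snd)).to₂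

theorem primrec_endRun : Primrec endRun :=
  nat_casesOn₁ _ (Memory.primrec_toss.comp
    (Primrec.pair .id (Primrec.const (0, []))))

theorem primrec_crossAnswer :
    Primrec fun z : Fin 2 × List ℕ × List ℕ => crossAnswer z.1 z.2.1 z.2.2 :=
  Primrec.ite (Primrec.eq.comp fst (Primrec.const 0))
    (option_some.comp snd) (option_some.comp (Primrec.pair (snd.comp snd) (fst.comp snd)))

theorem primrec_reachLeaf :
    Primrec fun z : Progress × (Fin 2 × List ℕ) × ℕ => reachLeaf z.1 z.2.1 z.2.2 := by
  refine option_casesOn (primrec_lookup.comp (snd.comp (snd.comp fst)) (snd.comp snd)) ?_ ?_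
  · exact Memory.primrec_toss.comp (Primrec.pair (fst.comp fst)
      (Primrec.pair (succ.comp (fst.comp (snd.comp fst)))
        (list_cons.comp (Primrec.pair (snd.comp snd) (fst.comp snd)) (snd.comp (snd.comp fst)))))
  · refine (Primrec.ite (Primrec.eq.comp (fst.comp snd) (fst.comp (fst.comp (snd.comp fst))))
      (primrec_endRun.comp (fst.comp (fst.comp fst))) (Memory.primrec_halt.comp
      (primrec_crossAnswer.comp (Primrec.pair (fst.comp (fst.comp (snd.comp fst)))
        (Primrec.pair (snd.comp (fst.comp (snd.comp fst))) (snd.comp snd)))))).to₂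

theorem primrec_reachNode :
    Primrec fun z : Progress × Walk × ℕ => reachNode z.1 z.2.1 z.2.2 := by
  refine nat_casesOn (snd.comp (fst.comp snd)) ?_ ?_
  · exact Memory.primrec_toss.comp (Primrec.pair (fst.comp fst)
      (Primrec.pair (succ.comp (fst.comp (snd.comp fst))) (snd.comp (snd.comp fst))))
  · exact (Memory.primrec_branch.comp (Primrec.pair (fst.comp fst)
      (Primrec.pair (Primrec.pair (fst.comp (fst.comp (snd.comp fst))) snd)
        (snd.comp (snd.comp fst))))).to₂

theorem primrec_checkRoots :
    Primrec fun z : ℕ × NodeInfo × NodeInfo => checkRoots z.1 z.2.1 z.2.2 := by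
  have inl : Primrec₂ fun (z : ℕ × ℕ) j => checkRoots z.1 (.inl z.2) j :=
    primrec₂_sum (Primrec.ite (Primrec.eq.comp (snd.comp fst) snd) (Primrec.const _)
      (Primrec.const _)).to₂ (Primrec.const _).to₂
  have inr : Primrec₂ fun (z : ℕ × ℕ) j => checkRoots z.1 (.inr z.2) j :=
    primrec₂_sum (Primrec.const _).to₂ (Memory.primrec_toss.comp
      (Primrec.pair (fst.comp fst) (Primrec.const (0, [])))).to₂
  have h : Primrec₂ fun (z : ℕ × NodeInfo) i => checkRoots z.1 i z.2 :=
    primrec₂_sum (inl.comp (Primrec.pair (fst.comp fst) snd) (snd.comp fst)).to₂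
      (inr.comp (Primrec.pair (fst.comp fst) snd) (snd.comp fst)).to₂
  exact h.comp (Primrec.pair fst (snd.comp snd)) (fst.comp snd)

theorem primrec_action : Primrec action := by
  have h : Primrec₂ fun (_ : Unit) => action := by
    refine Memory.primrec₂_of_cases ?_ ?_ ?_ ?_ ?_
    · exact (sumInr.comp (sumInr.comp snd)).to₂
    · have : Primrec₂ fun (_ : Unit) (o : Option NodeInfo) => (o.elim 0 fun _ => 1 : Fin 2) :=
        primrec₂_option (Primrec.const 0) (Primrec.const 1).to₂
      exact (sumInl.comp (Primrec.pair (this.comp fst (snd.comp snd)) (Primrec.const []))).to₂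
    · exact (Primrec.const _).to₂
    · exact (sumInl.comp (fst.comp (snd.comp snd))).to₂
    · exact (sumInr.comp (sumInl.comp (pred.comp (snd.comp (snd.comp snd))))).to₂
  exact h.comp (Primrec.const ()) .id

theorem primrec_onReply : Primrec₂ onReply := by
  refine Memory.primrec₂_of_cases (Primrec.const _).to₂ ?_ (Primrec.const _).to₂ ?_
    (Primrec.const _).to₂
  · have h : Primrec₂ fun (z : ℕ × NodeInfo) o => onReply (some z.2) (.check z.1 o) :=
      primrec₂_option (Memory.primrec_check.comp fst (option_some.comp snd))
        (primrec_checkRoots.comp (Primrec.pair (fst.comp fst)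
          (Primrec.pair snd (snd.comp fst)))).to₂
    have h' : Primrec₂ fun (z : ℕ × Option NodeInfo) r => onReply r (.check z.1 z.2) :=
      primrec₂_option (Primrec.const _)
        (h.comp (Primrec.pair (fst.comp fst) snd) (snd.comp fst)).to₂
    exact h'.swap
  · have h : Primrec₂ fun (z : Progress × Walk) r => onReply r (.visit z.1 z.2) := by
      refine primrec₂_option (Primrec.const _) (primrec₂_sum ?_ ?_)
      · exact (primrec_reachLeaf.comp (Primrec.pair (fst.comp fst)
          (Primrec.pair (fst.comp (snd.comp fst)) snd))).to₂
      · exact (primrec_reachNode.comp (Primrec.pair (fst.comp fst)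
          (Primrec.pair (snd.comp fst) snd))).to₂
    exact h.swap

theorem primrec_onDraw : Primrec₂ onDraw := by
  refine Memory.primrec₂_of_cases (Primrec.const _).to₂ (Primrec.const _).to₂ ?_
    (Primrec.const _).to₂ ?_
  · exact (Memory.primrec_visit.comp snd (Primrec.pair (Primrec.pair
      (Primrec.ite (Primrec.eq.comp fst (Primrec.const 0)) (Primrec.const 0) (Primrec.const 1))
      (Primrec.const [])) (primrec_walkBound.comp (fst.comp (snd.comp snd))))).to₂
  · exact (Memory.primrec_visit.comp (fst.comp snd) (Primrec.pair (Primrec.pair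
      (fst.comp (fst.comp (fst.comp (snd.comp snd))))
      (list_append.comp (snd.comp (fst.comp (fst.comp (snd.comp snd))))
        (list_cons.comp fst (Primrec.const []))))
      (snd.comp (fst.comp (snd.comp snd))))).to₂

end Primrec

/-- Independent runs of a collision search between random leaves of the two trees. -/
noncomputable def algorithm : ExplorationAlgorithm where
  State := Memory
  -- The counter holds the runs that remain after the current one, hence the predecessor. With no
  -- runs at all, `ε ≥ 1` and `⊥` is an admissible answer.
  start ε := (⌈Real.logb 2 (1 / ε)⌉₊).casesOn (Memory.halt none) fun r => Memory.check r none
  act := action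
  afterRequest m r := onReply r m
  afterDraw m k := onDraw k m
  computable_act := primrec_action.to_comp
  computable_afterRequest := primrec_onReply.swap.to_comp
  computable_afterDraw := primrec_onDraw.swap.to_comp

end CollisionSearch

/-! ### Random walks in search trees -/

namespace SearchTree

/-- The expected value of `f` at the outcome of a random walk of at most `D` steps that starts at
the root and stops at the leaves. The outcome is the colour of the leaf that has been reached, or
`none` if no leaf has been reached. -/
noncomputable def walkMean (f : Option ℕ → ℝ) : SearchTree → ℕ → ℝ
  | leaf c, _ => f (some c)
  | node _ _, 0 => f none
  | node k child, D + 1 => (∑ i, (child i).walkMean f D) / (k + 2)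

/-- The colours of the leaves. -/
def colors : SearchTree → Finset ℕ
  | leaf c => {c}
  | node _ child => Finset.univ.biUnion fun i => (child i).colors

theorem card_colors_le_size : ∀ T : SearchTree, T.colors.card ≤ T.size
  | leaf _ => by simp [colors, size]
  | node k child => by
    rw [colors, size]
    exact (Finset.card_biUnion_le.trans
      (Finset.sum_le_sum fun i _ => (child i).card_colors_le_size)).trans (Nat.le_add_left _ _)

theorem one_le_size : ∀ T : SearchTree, 1 ≤ T.size
  | leaf _ => le_rfl
  | node _ _ => Nat.le_add_right _ _

theorem three_le_size_node (k : ℕ) (child : Fin (k + 2) → SearchTree) :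
    3 ≤ (node k child).size := by
  have h : ∑ _i : Fin (k + 2), 1 ≤ ∑ i, (child i).size :=
    Finset.sum_le_sum fun i _ => (child i).one_le_size
  simp only [Finset.sum_const, Finset.card_univ, Fintype.card_fin, smul_eq_mul, mul_one] at h
  rw [size]
  omega

section walkMean

variable {f g : Option ℕ → ℝ}

theorem walkMean_mono (h : ∀ x, f x ≤ g x) (T : SearchTree) (D : ℕ) :
    T.walkMean f D ≤ T.walkMean g D := by
  induction T generalizing D with
  | leaf c => exact h _
  | node k child ih =>
    cases D with
    | zero => exact h _
    | succ D =>
      simp only [walkMean]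
      gcongr with i
      exact ih i D

theorem walkMean_congr (T : SearchTree) (hf : ∀ c ∈ T.colors, f (some c) = g (some c))
    (hn : f none = g none) (D : ℕ) : T.walkMean f D = T.walkMean g D := by
  induction T generalizing D with
  | leaf c => exact hf c (by simp [colors])
  | node k child ih =>
    cases D with
    | zero => exact hn
    | succ D =>
      simp only [walkMean]
      congr 1
      refine Finset.sum_congr rfl fun i _ => ih i (fun c hc => hf c ?_) D
      simp only [colors, Finset.mem_biUnion, Finset.mem_univ, true_and]
      exact ⟨i, hc⟩

theorem walkMean_const (a : ℝ) (T : SearchTree) (D : ℕ) : T.walkMean (fun _ => a) D = a := by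
  induction T generalizing D with
  | leaf c => rfl
  | node k child ih =>
    cases D with
    | zero => rfl
    | succ D =>
      simp only [walkMean, ih, Finset.sum_const, Finset.card_univ, Fintype.card_fin, nsmul_eq_mul]
      push_cast
      field_simp

theorem walkMean_add (T : SearchTree) (D : ℕ) :
    T.walkMean (fun x => f x + g x) D = T.walkMean f D + T.walkMean g D := by
  induction T generalizing D with
  | leaf c => rfl
  | node k child ih =>
    cases D with
    | zero => rfl
    | succ D => simp only [walkMean, ih, Finset.sum_add_distrib, add_div]

theorem walkMean_const_mul (a : ℝ) (T : SearchTree) (D : ℕ) :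
    T.walkMean (fun x => a * f x) D = a * T.walkMean f D := by
  induction T generalizing D with
  | leaf c => rfl
  | node k child ih =>
    cases D with
    | zero => rfl
    | succ D => simp only [walkMean, ih, ← Finset.mul_sum, mul_div_assoc]

theorem walkMean_sum {ι : Type*} (S : Finset ι) (f : ι → Option ℕ → ℝ) (T : SearchTree) (D : ℕ) :
    T.walkMean (fun x => ∑ i ∈ S, f i x) D = ∑ i ∈ S, T.walkMean (f i) D := by
  classical
  induction S using Finset.induction_on with
  | empty => simpa using walkMean_const 0 T D
  | insert i S hi ih => simp only [Finset.sum_insert hi, walkMean_add, ih]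

theorem walkMean_nonneg (h : ∀ x, 0 ≤ f x) (T : SearchTree) (D : ℕ) : 0 ≤ T.walkMean f D :=
  (walkMean_const 0 T D).ge.trans (walkMean_mono h T D)

/-- Lengthening a walk only affects outcomes that counted as 0. Thus an estimate for one fixed
length serves all longer walks. -/
theorem walkMean_le_walkMean (h : ∀ x, 0 ≤ f x) (hn : f none = 0) (T : SearchTree) {D E : ℕ}
    (hDE : D ≤ E) : T.walkMean f D ≤ T.walkMean f E := by
  induction T generalizing D E with
  | leaf c => rfl
  | node k child ih =>
    cases D with
    | zero => exact hn.le.trans (walkMean_nonneg h _ _)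
    | succ D =>
      obtain ⟨E, rfl⟩ : ∃ E', E = E' + 1 := ⟨E - 1, by omega⟩
      simp only [walkMean]
      gcongr with i
      exact ih i (by omega)

/-- Long walks are rare, since every inner node has at least two children. -/
theorem walkMean_none_le (T : SearchTree) (D : ℕ) :
    T.walkMean (fun x => if x = none then 1 else 0) D ≤ T.size / 2 ^ D := by
  induction T generalizing D with
  | leaf c =>
    simp only [walkMean, reduceCtorEq, if_false]
    positivity
  | node k child ih =>
    cases D with
    | zero =>
      simp only [walkMean, if_true, pow_zero, div_one]
      exact_mod_cast one_le_size _
    | succ D =>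
      have hs : (∑ i, ((child i).size : ℝ)) ≤ (node k child).size := by
        rw [size]; push_cast; linarith
      calc (node k child).walkMean (fun x => if x = none then 1 else 0) (D + 1)
          ≤ (∑ i, ((child i).size : ℝ) / 2 ^ D) / (k + 2) := by
            simp only [walkMean]
            gcongr with i
            exact ih i D
        _ ≤ (node k child).size / 2 ^ D / 2 := by
            rw [← Finset.sum_div]
            gcongr
            linarith [(Nat.cast_nonneg k : (0 : ℝ) ≤ k)]
        _ = _ := by rw [div_div, pow_succ]

end walkMean

/-! ### Addresses -/

theorem subtreeAt_nil (T : SearchTree) : T.subtreeAt [] = some T := by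
  cases T <;> rfl

theorem subtreeAt_append (T : SearchTree) (p q : List ℕ) :
    T.subtreeAt (p ++ q) = (T.subtreeAt p).bind fun S => S.subtreeAt q := by
  induction p generalizing T with
  | nil => simp [subtreeAt_nil]
  | cons i p ih =>
    cases T with
    | leaf c => rfl
    | node k child =>
      simp only [List.cons_append, subtreeAt]
      split_ifs with h
      · exact ih _
      · rfl

theorem subtreeAt_child {T : SearchTree} {p : List ℕ} {k : ℕ} {child : Fin (k + 2) → SearchTree}
    (h : T.subtreeAt p = some (node k child)) (i : Fin (k + 2)) :
    T.subtreeAt (p ++ [i.1]) = some (child i) := by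
  simp [subtreeAt_append, h, subtreeAt, subtreeAt_nil]

theorem exists_parent {T S : SearchTree} {p : List ℕ} {i : ℕ}
    (h : T.subtreeAt (p ++ [i]) = some S) :
    ∃ k child, T.subtreeAt p = some (node k child) ∧ i < k + 2 := by
  rw [subtreeAt_append] at h
  rcases hp : T.subtreeAt p with _ | (c | ⟨k, child⟩)
  · simp [hp] at h
  · simp [hp, subtreeAt] at h
  · refine ⟨k, child, rfl, ?_⟩
    by_contra hi
    simp [hp, subtreeAt, hi] at h

theorem info_eq_of_subtreeAt {T S : SearchTree} {p : List ℕ} (h : T.subtreeAt p = some S) :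
    T.info p = some S.rootInfo := by
  rw [info, h, Option.map_some]

theorem exists_subtreeAt {T : SearchTree} (v : T.Vertex) : ∃ S, T.subtreeAt v.1 = some S := by
  have h := v.2
  rw [info, Option.isSome_map] at h
  exact Option.isSome_iff_exists.1 h

/-- The node with a given address. -/
def vertexOfSubtreeAt {T S : SearchTree} {p : List ℕ} (h : T.subtreeAt p = some S) : T.Vertex :=
  ⟨p, by rw [info_eq_of_subtreeAt h]; rfl⟩

/-! ### Isomorphism invariance of random walks -/

section Iso

variable {T T' : SearchTree} {φ : T.Vertex ≃ T'.Vertex}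

/-- The isomorphism permutes children, and a uniform choice of a child does not depend on their
order. -/
theorem IsColorIso.walkMean_subtree_eq (hφ : IsColorIso φ) (f : Option ℕ → ℝ) (D : ℕ)
    {v : T.Vertex} {S S' : SearchTree} (hS : T.subtreeAt v.1 = some S)
    (hS' : T'.subtreeAt (φ v).1 = some S') : S.walkMean f D = S'.walkMean f D := by
  induction D generalizing v S S' with
  | zero =>
    cases S with
    | leaf c =>
      have h := hφ.2 v c (info_eq_of_subtreeAt hS)
      rw [IsLeafOfColor, info_eq_of_subtreeAt hS'] at h
      cases S' <;> simp_all [rootInfo, walkMean]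
    | node k child =>
      cases S' with
      | leaf c =>
        -- Colours are only transported forwards, so an inner node is kept from becoming a leaf by
        -- the image of one of its children.
        have h : IsChild (φ (vertexOfSubtreeAt (subtreeAt_child hS 0))) (φ v) :=
          (hφ.1 _ _).1 ⟨_, rfl⟩
        obtain ⟨i, hi⟩ := h
        obtain ⟨U, hU⟩ := exists_subtreeAt (φ (vertexOfSubtreeAt (subtreeAt_child hS 0)))
        rw [hi] at hU
        obtain ⟨_, _, h, _⟩ := exists_parent hU
        simp [hS'] at h
      | node k' child' => rfl
  | succ D ih =>
    cases S with
    | leaf c =>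
      have h := hφ.2 v c (info_eq_of_subtreeAt hS)
      rw [IsLeafOfColor, info_eq_of_subtreeAt hS'] at h
      cases S' <;> simp_all [rootInfo, walkMean]
    | node k child =>
      have hchild (i : Fin (k + 2)) :
          ∃ k' child', S' = node k' child' ∧ ∃ j < k' + 2,
            (φ (vertexOfSubtreeAt (subtreeAt_child hS i))).1 = (φ v).1 ++ [j] := by
        obtain ⟨j, hj⟩ : IsChild (φ (vertexOfSubtreeAt (subtreeAt_child hS i))) (φ v) :=
          (hφ.1 _ _).1 ⟨_, rfl⟩
        obtain ⟨U, hU⟩ := exists_subtreeAt (φ (vertexOfSubtreeAt (subtreeAt_child hS i)))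
        rw [hj] at hU
        obtain ⟨k', child', h, hlt⟩ := exists_parent hU
        exact ⟨k', child', Option.some_injective _ (hS'.symm.trans h), j, hlt, hj⟩
      obtain ⟨k', child', rfl, -⟩ := hchild 0
      have hchild' (i : Fin (k + 2)) : ∃ j : Fin (k' + 2),
          (φ (vertexOfSubtreeAt (subtreeAt_child hS i))).1 = (φ v).1 ++ [j.1] := by
        obtain ⟨_, _, h, j, hj, hij⟩ := hchild i
        cases h
        exact ⟨⟨j, hj⟩, hij⟩
      -- The induced map on child indices is a bijection, by injectivity of `φ` and by pulling
      -- children back along `φ.symm`; in particular the arities agree.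
      choose e he using hchild'
      have hinj : Function.Injective e := by
        intro i j hij
        have h := (he i).trans ((congrArg (fun a : Fin (k' + 2) => (φ v).1 ++ [a.1]) hij).trans
          (he j).symm)
        have h' := congrArg Subtype.val (φ.injective (Subtype.ext h))
        simpa [vertexOfSubtreeAt, Fin.ext_iff] using h'
      have hsurj : Function.Surjective e := by
        intro j
        have hw : IsChild (φ.symm (vertexOfSubtreeAt (subtreeAt_child hS' j))) v := by
          rw [hφ.1, φ.apply_symm_apply]
          exact ⟨_, rfl⟩
        obtain ⟨i, hi⟩ := hw
        obtain ⟨U, hU⟩ := exists_subtreeAt (φ.symm (vertexOfSubtreeAt (subtreeAt_child hS' j)))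
        rw [hi] at hU
        obtain ⟨_, _, h, hlt⟩ := exists_parent hU
        rw [hS] at h
        cases h
        refine ⟨⟨i, hlt⟩, ?_⟩
        have hv : vertexOfSubtreeAt (subtreeAt_child hS ⟨i, hlt⟩) =
            φ.symm (vertexOfSubtreeAt (subtreeAt_child hS' j)) := Subtype.ext hi.symm
        have h := he ⟨i, hlt⟩
        rw [hv, φ.apply_symm_apply] at h
        simpa [vertexOfSubtreeAt, Fin.ext_iff, eq_comm] using h
      have hk : k = k' := by
        simpa using Fintype.card_of_bijective ⟨hinj, hsurj⟩
      subst hk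
      simp only [walkMean]
      congr 1
      refine Fintype.sum_bijective e ⟨hinj, hsurj⟩ _ _ fun i => ?_
      refine ih (v := vertexOfSubtreeAt (subtreeAt_child hS i)) (subtreeAt_child hS i) ?_
      rw [he i]
      exact subtreeAt_child hS' (e i)

theorem IsColorIso.map_root (hφ : IsColorIso φ) :
    (φ (vertexOfSubtreeAt (subtreeAt_nil T))).1 = [] := by
  rcases List.eq_nil_or_concat (φ (vertexOfSubtreeAt (subtreeAt_nil T))).1 with h | ⟨p, i, h⟩
  · exact h
  · obtain ⟨U, hU⟩ := exists_subtreeAt (φ (vertexOfSubtreeAt (subtreeAt_nil T)))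
    rw [h, List.concat_eq_append] at hU
    obtain ⟨_, _, hp, _⟩ := exists_parent hU
    -- A parent of the image of the root would pull back to a parent of the root.
    have hc : IsChild (vertexOfSubtreeAt (subtreeAt_nil T)) (φ.symm (vertexOfSubtreeAt hp)) := by
      rw [hφ.1, φ.apply_symm_apply]
      exact ⟨i, h.trans List.concat_eq_append⟩
    obtain ⟨j, hj⟩ := hc
    simp [vertexOfSubtreeAt] at hj

theorem IsColorIso.walkMean_eq (hφ : IsColorIso φ) (f : Option ℕ → ℝ) (D : ℕ) :
    T.walkMean f D = T'.walkMean f D := by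
  refine hφ.walkMean_subtree_eq f D (v := vertexOfSubtreeAt (subtreeAt_nil T)) (subtreeAt_nil T) ?_
  rw [hφ.map_root]
  exact subtreeAt_nil T'

theorem IsColorIso.rootInfo_eq_leaf (hφ : IsColorIso φ) (c : ℕ) :
    T.rootInfo = .inl c → T'.rootInfo = .inl c := by
  intro h
  have h' := hφ.2 (vertexOfSubtreeAt (subtreeAt_nil T)) c
    ((info_eq_of_subtreeAt (subtreeAt_nil T)).trans (congrArg some h))
  rw [hφ.map_root, IsLeafOfColor, info_eq_of_subtreeAt (subtreeAt_nil T')] at h'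
  exact Option.some_injective _ h'

end Iso

end SearchTree

/-! ### Expected values along the computation -/

namespace ExplorationAlgorithm

variable (A : ExplorationAlgorithm) (T : Fin 2 → SearchTree)

/-- The expected value of `g` after one step. -/
noncomputable def stepMean (g : A.Config → ℝ≥0∞) (c : A.Config) : ℝ≥0∞ :=
  ∑' c', A.step T c c' * g c'

/-- The expected value of `g` after `n` steps. -/
noncomputable def runMean (ε : ℝ) (n : ℕ) (g : A.Config → ℝ≥0∞) : ℝ≥0∞ :=
  ∑' c, A.run T ε n c * g c

variable {A T}

theorem runMean_zero (ε : ℝ) (g : A.Config → ℝ≥0∞) : A.runMean T ε 0 g = g (A.initial ε) := by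
  rw [runMean, tsum_eq_single (A.initial ε)]
  · simp [run]
  · intro c hc
    simp [run, hc]

theorem runMean_succ (ε : ℝ) (n : ℕ) (g : A.Config → ℝ≥0∞) :
    A.runMean T ε (n + 1) g = A.runMean T ε n (A.stepMean T g) := by
  simp only [runMean, run, PMF.bind_apply, stepMean, ← ENNReal.tsum_mul_right,
    ← ENNReal.tsum_mul_left]
  rw [ENNReal.tsum_comm]
  simp only [mul_assoc]

theorem runMean_mono_of_support {ε : ℝ} {n : ℕ} {g h : A.Config → ℝ≥0∞}
    (H : ∀ c ∈ (A.run T ε n).support, g c ≤ h c) : A.runMean T ε n g ≤ A.runMean T ε n h := by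
  refine ENNReal.tsum_le_tsum fun c => ?_
  by_cases hc : c ∈ (A.run T ε n).support
  · gcongr
    exact H c hc
  · rw [PMF.mem_support_iff, not_not] at hc
    simp [hc]

theorem runMean_add (ε : ℝ) (n : ℕ) (g h : A.Config → ℝ≥0∞) :
    A.runMean T ε n (fun c => g c + h c) = A.runMean T ε n g + A.runMean T ε n h := by
  simp only [runMean, mul_add, ENNReal.tsum_add]

theorem runMean_one (ε : ℝ) (n : ℕ) : A.runMean T ε n (fun _ => 1) = 1 := by
  simp only [runMean, mul_one, PMF.tsum_coe]

open Classical in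
theorem toOuterMeasure_run_eq (ε : ℝ) (n : ℕ) (S : Set A.Config) :
    (A.run T ε n).toOuterMeasure S = A.runMean T ε n fun c => if c ∈ S then 1 else 0 := by
  rw [PMF.toOuterMeasure_apply, runMean]
  refine tsum_congr fun c => ?_
  by_cases hc : c ∈ S <;> simp [hc]

theorem step_draw {c : A.Config} {m : ℕ} (h : A.act c.mem = .inr (.inl m)) :
    A.step T c = (PMF.uniformOfFintype (Fin (m + 1))).bind fun k =>
      PMF.pure ⟨A.afterDraw c.mem k.1, c.explored⟩ := by
  simp only [step, h]
  exact (PMF.bind_bind _ _ _).trans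
    (congrArg _ (funext fun k => PMF.pure_bind k.1 _))

theorem mem_support_step {c c' : A.Config} (h : c' ∈ (A.step T c).support) :
    (∃ i p, A.act c.mem = .inl (i, p) ∧ c' = A.request T c i p) ∨
    (∃ m, A.act c.mem = .inr (.inl m) ∧ ∃ k < m + 1, c' = ⟨A.afterDraw c.mem k, c.explored⟩) ∨
    ((∃ r, A.act c.mem = .inr (.inr r)) ∧ c' = c) := by
  rcases hc : A.act c.mem with ⟨i, p⟩ | m | r
  · refine .inl ⟨i, p, rfl, ?_⟩
    simpa [step, hc] using h
  · refine .inr (.inl ⟨m, rfl, ?_⟩)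
    simp only [step_draw hc, PMF.mem_support_bind_iff, PMF.mem_support_pure_iff] at h
    obtain ⟨k, -, hk⟩ := h
    exact ⟨k, k.2, hk⟩
  · refine .inr (.inr ⟨⟨r, rfl⟩, ?_⟩)
    simpa [step, hc] using h

/-- `Inv` is preserved by all steps of the computation. -/
def IsInvariant (A : ExplorationAlgorithm) (T : Fin 2 → SearchTree) (Inv : A.Config → Prop) :
    Prop :=
  (∀ c i p, Inv c → A.act c.mem = .inl (i, p) → Inv (A.request T c i p)) ∧
  ∀ c m, Inv c → A.act c.mem = .inr (.inl m) → ∀ k < m + 1,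
    Inv ⟨A.afterDraw c.mem k, c.explored⟩

theorem IsInvariant.of_mem_support {Inv : A.Config → Prop} (hInv : IsInvariant A T Inv) {ε : ℝ}
    (h0 : Inv (A.initial ε)) {n : ℕ} {c : A.Config} (hc : c ∈ (A.run T ε n).support) : Inv c := by
  induction n generalizing c with
  | zero =>
    rw [run, PMF.mem_support_pure_iff] at hc
    exact hc ▸ h0
  | succ n ih =>
    rw [run, PMF.mem_support_bind_iff] at hc
    obtain ⟨b, hb, hc⟩ := hc
    rcases mem_support_step hc with ⟨i, p, h, rfl⟩ | ⟨m, h, k, hk, rfl⟩ | ⟨-, rfl⟩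
    · exact hInv.1 b i p (ih hb) h
    · exact hInv.2 b m (ih hb) h k hk
    · exact ih hb

/-- Moves the supermartingale inequality to the reals, where linear arithmetic is available. Final
configurations repeat forever, so nothing can be charged to them. -/
theorem stepMean_ofReal_le {G : A.Config → ℝ} (hG : ∀ c, 0 ≤ G c) {e : ℝ} (he : 0 ≤ e)
    {c : A.Config} (hreq : ∀ i p, A.act c.mem = .inl (i, p) → G (A.request T c i p) + e ≤ G c)
    (hdraw : ∀ m, A.act c.mem = .inr (.inl m) →
      (∑ k : Fin (m + 1), G ⟨A.afterDraw c.mem k, c.explored⟩) / (m + 1) + e ≤ G c)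
    (hhalt : ∀ r, A.act c.mem = .inr (.inr r) → e = 0) :
    A.stepMean T (fun c => ENNReal.ofReal (G c)) c + ENNReal.ofReal e ≤ ENNReal.ofReal (G c) := by
  rcases hc : A.act c.mem with ⟨i, p⟩ | m | r
  · have h : A.stepMean T (fun c => ENNReal.ofReal (G c)) c =
        ENNReal.ofReal (G (A.request T c i p)) := by
      simp only [stepMean, step, hc]
      rw [tsum_eq_single (A.request T c i p)]
      · simp
      · intro b hb
        simp [hb]
    rw [h, ← ENNReal.ofReal_add (hG _) he]
    exact ENNReal.ofReal_le_ofReal (hreq i p hc)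
  · have h : A.stepMean T (fun c => ENNReal.ofReal (G c)) c =
        ENNReal.ofReal ((∑ k : Fin (m + 1), G ⟨A.afterDraw c.mem k, c.explored⟩) / (m + 1)) := by
      simp only [stepMean, step_draw hc, PMF.bind_apply, ← ENNReal.tsum_mul_right]
      rw [ENNReal.tsum_comm, tsum_fintype, Finset.sum_div,
        ENNReal.ofReal_sum_of_nonneg fun k _ => div_nonneg (hG _) (by positivity)]
      refine Finset.sum_congr rfl fun k _ => ?_
      rw [tsum_eq_single ⟨A.afterDraw c.mem k, c.explored⟩]
      · rw [div_eq_inv_mul, ENNReal.ofReal_mul (by positivity),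
          ENNReal.ofReal_inv_of_pos (by positivity)]
        have : ENNReal.ofReal ((m : ℝ) + 1) = (m : ℝ≥0∞) + 1 := by
          rw [ENNReal.ofReal_add (by positivity) zero_le_one]
          simp
        simp [this]
      · intro b hb
        simp [hb]
    rw [h, ← ENNReal.ofReal_add (div_nonneg (Finset.sum_nonneg fun k _ => hG _) (by positivity)) he]
    exact ENNReal.ofReal_le_ofReal (hdraw m hc)
  · have h : A.stepMean T (fun c => ENNReal.ofReal (G c)) c = ENNReal.ofReal (G c) := by
      simp only [stepMean, step, hc]
      rw [tsum_eq_single c]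
      · simp
      · intro b hb
        simp [hb]
    rw [h, hhalt r hc, ENNReal.ofReal_zero, add_zero]

/-- Telescoping: the initial potential pays for all charges `e` and for the remaining potential. -/
theorem runMean_add_sum_le {Inv : A.Config → Prop} (hInv : IsInvariant A T Inv) {ε : ℝ}
    (h0 : Inv (A.initial ε)) {g e : A.Config → ℝ≥0∞}
    (H : ∀ c, Inv c → A.stepMean T g c + e c ≤ g c) (n : ℕ) :
    A.runMean T ε n g + ∑ j ∈ Finset.range n, A.runMean T ε j e ≤ g (A.initial ε) := by
  induction n with
  | zero => simp [runMean_zero]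
  | succ n ih =>
    refine le_trans ?_ ih
    rw [runMean_succ, Finset.sum_range_succ, add_left_comm, add_comm (A.runMean T ε n g),
      ← runMean_add]
    gcongr
    exact runMean_mono_of_support fun c hc => H c (hInv.of_mem_support h0 hc)

/-! ### Halting -/

/-- The configuration `c` is not final. -/
def IsActive (c : A.Config) : Prop := ∀ r, A.act c.mem ≠ .inr (.inr r)

open Classical in
/-- The probability that the algorithm has not halted after `n` steps. -/
noncomputable def activeProb (A : ExplorationAlgorithm) (T : Fin 2 → SearchTree) (ε : ℝ) (n : ℕ) :
    ℝ≥0∞ :=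
  A.runMean T ε n fun c => if IsActive c then 1 else 0

/-- The sum of these probabilities is the expected number of steps; if it is finite, its terms tend
to 0. -/
theorem tendsto_activeProb {ε : ℝ} {K : ℝ≥0∞} (hK : K ≠ ⊤)
    (h : ∀ n, ∑ j ∈ Finset.range n, activeProb A T ε j ≤ K) :
    Filter.Tendsto (activeProb A T ε) Filter.atTop (nhds 0) := by
  have hs : ∑' j, activeProb A T ε j ≤ K := ENNReal.tsum_le_of_sum_range_le h
  exact ENNReal.tendsto_atTop_zero_of_tsum_ne_top (ne_top_of_le_ne_top hK hs)

open Classical in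
/-- If the algorithm halts almost surely, and with an answer in `S` up to probability `δ`, then
its answer is in `S` with probability at least `1 - δ`. -/
theorem one_le_answerProb_add {ε : ℝ} {S : Set Answer} {δ : ℝ≥0∞}
    (hlim : Filter.Tendsto (activeProb A T ε) Filter.atTop (nhds 0))
    (h : ∀ n, A.runMean T ε n
      (fun c => if ∃ r ∉ S, A.act c.mem = .inr (.inr r) then 1 else 0) ≤ δ) :
    1 ≤ A.answerProb T ε S + δ := by
  have key (n : ℕ) : 1 ≤ A.answerProb T ε S + δ + activeProb A T ε n := by
    calc (1 : ℝ≥0∞) = A.runMean T ε n (fun _ => 1) := (runMean_one ε n).symm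
      _ ≤ A.runMean T ε n (fun c =>
            ((if c ∈ {c : A.Config | ∃ r ∈ S, A.act c.mem = .inr (.inr r)} then 1 else 0) +
            (if ∃ r ∉ S, A.act c.mem = .inr (.inr r) then 1 else 0)) +
            if IsActive c then 1 else 0) := by
          refine runMean_mono_of_support fun c _ => ?_
          by_cases hc : IsActive c
          · simp [hc]
          · obtain ⟨r, hr⟩ : ∃ r, A.act c.mem = .inr (.inr r) := by
              simpa [IsActive] using hc
            by_cases hS : r ∈ S <;> simp [hr, hS]
      _ = A.runMean T ε n (fun c =>
            if c ∈ {c : A.Config | ∃ r ∈ S, A.act c.mem = .inr (.inr r)} then 1 else 0) +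
            A.runMean T ε n (fun c => if ∃ r ∉ S, A.act c.mem = .inr (.inr r) then 1 else 0) +
            activeProb A T ε n := by
          rw [runMean_add, runMean_add, activeProb]
      _ ≤ _ := by
          gcongr
          · rw [← toOuterMeasure_run_eq]
            exact le_iSup (fun n => (A.run T ε n).toOuterMeasure
              {c | ∃ r ∈ S, A.act c.mem = .inr (.inr r)}) n
          · exact h n
  have := ge_of_tendsto' (hlim.const_add (A.answerProb T ε S + δ)) key
  rwa [add_zero] at this

theorem answerProb_le_one (ε : ℝ) (S : Set Answer) : A.answerProb T ε S ≤ 1 :=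
  iSup_le fun n => by
    classical
    rw [toOuterMeasure_run_eq]
    refine (runMean_mono_of_support fun c _ => ?_).trans_eq (runMean_one ε n)
    split_ifs <;> simp

end ExplorationAlgorithm

/-! ### Potentials for the collision search -/

namespace CollisionSearch

open SearchTree ExplorationAlgorithm

/-- The colours of the seen leaves. -/
def seenColors (L : List SeenLeaf) : Finset ℕ := (L.map Prod.fst).toFinset

theorem lookup_cons (e : SeenLeaf) (L : List SeenLeaf) (c : ℕ) :
    lookup (e :: L) c = if e.1 = c then some e.2 else lookup L c := rfl

theorem seenColors_cons (e : SeenLeaf) (L : List SeenLeaf) :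
    seenColors (e :: L) = insert e.1 (seenColors L) := by
  simp [seenColors]

theorem lookup_eq_none_iff {L : List SeenLeaf} {c : ℕ} :
    lookup L c = none ↔ c ∉ seenColors L := by
  induction L with
  | nil => simp [lookup, seenColors]
  | cons e L ih =>
    rw [lookup_cons, seenColors_cons]
    by_cases h : e.1 = c
    · simp [h]
    · simp [h, ih, Ne.symm h]

theorem mem_of_lookup_eq_some {L : List SeenLeaf} {c : ℕ} {u : Fin 2 × List ℕ}
    (h : lookup L c = some u) : (c, u) ∈ L := by
  induction L with
  | nil => simp [lookup] at h
  | cons e L ih =>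
    rw [lookup_cons] at h
    split_ifs at h with hc
    · cases h
      simp [← hc]
    · exact List.mem_cons_of_mem _ (ih h)

variable (T : Fin 2 → SearchTree)

/-- The entries of `L` are leaves of the given colours. -/
def IsValid (L : List SeenLeaf) : Prop := ∀ e ∈ L, (T e.2.1).IsLeafOfColor e.2.2 e.1

/-- The facts about the input that hold for the contents `m` of the memory and the set `X` of
explored nodes. -/
def Sound (X : Finset (Fin 2 × List ℕ)) : Memory → Prop
  | .halt a => ∀ p q, a = some (p, q) → IsMatch T p q
  | .check _ o => ∀ i, o = some i → i = (T 0).rootInfo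
  | .toss x => IsValid T x.2.2
  | .visit x w => IsValid T x.2.2 ∧ (w.1.1, w.1.2.dropLast) ∈ X ∧
      ∃ S, (T w.1.1).subtreeAt w.1.2 = some S
  | .branch x w d => IsValid T x.2.2 ∧ w.1 ∈ X ∧
      ∃ k child, (T w.1.1).subtreeAt w.1.2 = some (node k child) ∧ d = k + 2

/-- A configuration in which the roots are explored and the memory is sound. -/
def Consistent (c : algorithm.Config) : Prop :=
  (∀ s, (s, []) ∈ c.explored) ∧ Sound T c.explored c.mem

variable {T}

theorem request_eq {c : algorithm.Config} {s : Fin 2} {p : List ℕ} {S : SearchTree}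
    (h : (s, p.dropLast) ∈ c.explored) (hS : (T s).subtreeAt p = some S) :
    algorithm.request T c s p = ⟨onReply (some S.rootInfo) c.mem, insert (s, p) c.explored⟩ := by
  rw [request, info_eq_of_subtreeAt hS, if_pos ⟨h, rfl⟩]
  rfl

theorem sound_endRun (X : Finset (Fin 2 × List ℕ)) (r : ℕ) : Sound T X (endRun r) := by
  cases r with
  | zero => simp [endRun, Sound]
  | succ r => simp [endRun, Sound, IsValid]

theorem sound_reachLeaf (X : Finset (Fin 2 × List ℕ)) {x : Progress} {v : Fin 2 × List ℕ} {c : ℕ}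
    (hx : IsValid T x.2.2) (hv : (T v.1).IsLeafOfColor v.2 c) : Sound T X (reachLeaf x v c) := by
  rcases h : lookup x.2.2 c with _ | u
  · simp only [reachLeaf, h, Sound]
    intro e he
    rcases List.mem_cons.1 he with rfl | he
    · exact hv
    · exact hx e he
  · have hu := hx _ (mem_of_lookup_eq_some h)
    simp only [reachLeaf, h]
    split_ifs with hs
    · exact sound_endRun X _
    · intro p q hpq
      obtain ⟨s, v⟩ := v
      obtain ⟨s', u⟩ := u
      simp only at hs hu hv hpq
      fin_cases s <;> fin_cases s' <;> simp_all [crossAnswer] <;>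
        obtain ⟨rfl, rfl⟩ := hpq
      exacts [⟨c, hv, hu⟩, ⟨c, hu, hv⟩]

theorem sound_checkRoots (X : Finset (Fin 2 × List ℕ)) (r : ℕ) :
    Sound T X (checkRoots r (T 0).rootInfo (T 1).rootInfo) := by
  rcases h0 : (T 0).rootInfo with a | a <;> rcases h1 : (T 1).rootInfo with b | b
  · simp only [checkRoots]
    split_ifs with h
    · intro p q hpq
      cases hpq
      exact ⟨a, by rw [IsLeafOfColor, info_eq_of_subtreeAt (subtreeAt_nil _), h0],
        by rw [IsLeafOfColor, info_eq_of_subtreeAt (subtreeAt_nil _), h1, h]⟩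
    · simp [Sound]
  all_goals simp [checkRoots, Sound, IsValid]

/-- A visited address exists and has an explored parent, so every request is granted. Stored leaves
have their true colours, which makes the error one-sided. -/
theorem isInvariant_consistent : IsInvariant algorithm T (Consistent T) := by
  refine ⟨?_, ?_⟩
  · rintro ⟨m, X⟩ s p ⟨hr, hm⟩ hact
    rcases m with a | ⟨r, o⟩ | x | ⟨x, w⟩ | ⟨x, w, d⟩ <;>
      simp only [algorithm, action, reduceCtorEq, Sum.inl.injEq] at hact
    · cases hact
      rw [request_eq (hr _) (subtreeAt_nil _)]
      refine ⟨fun s => Finset.mem_insert_of_mem (hr s), ?_⟩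
      rcases o with _ | i
      · simp [onReply, Sound]
      · obtain rfl : i = (T 0).rootInfo := hm i rfl
        exact sound_checkRoots _ r
    · obtain ⟨⟨s', p'⟩, f⟩ := w
      cases hact
      obtain ⟨hx, hp, S, hS⟩ := hm
      rw [request_eq hp hS]
      refine ⟨fun s => Finset.mem_insert_of_mem (hr s), ?_⟩
      cases S with
      | leaf c => exact sound_reachLeaf _ hx (info_eq_of_subtreeAt hS)
      | node k child =>
        cases f with
        | zero => exact hx
        | succ f => exact ⟨hx, Finset.mem_insert_self _ _, k, child, hS, rfl⟩
  · rintro ⟨m, X⟩ n ⟨hr, hm⟩ hact i hi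
    rcases m with a | ⟨r, o⟩ | x | ⟨x, w⟩ | ⟨x, w, d⟩ <;>
      simp only [algorithm, action, reduceCtorEq, Sum.inr.injEq, Sum.inl.injEq] at hact
    · exact ⟨hr, hm, hr _, _, subtreeAt_nil _⟩
    · obtain ⟨hx, hp, k, child, hS, rfl⟩ := hm
      subst hact
      refine ⟨hr, hx, ?_, _, subtreeAt_child hS ⟨i, hi⟩⟩
      simpa [algorithm, onDraw] using hp

theorem consistent_initial (ε : ℝ) : Consistent T (algorithm.initial ε) := by
  refine ⟨fun s => by fin_cases s <;> simp [initial], ?_⟩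
  simp only [initial, algorithm]
  cases ⌈Real.logb 2 (1 / ε)⌉₊ <;> simp [Sound]

/-! ### From samples to steps -/

section Potential

variable (T) (κ g₀ : ℝ) (G : ℕ → ℕ → Finset ℕ → ℝ)

/-- The value after an unsuccessful run. -/
def endValue (r : ℕ) : ℝ := r.casesOn g₀ fun r => G r 0 ∅

/-- The value after a sample from the tree `s` with a given outcome. -/
def outcomeValue (x : Progress) (s : Fin 2) : Option ℕ → ℝ
  | none => G x.1 (x.2.1 + 1) (seenColors x.2.2)
  | some c => (lookup x.2.2 c).casesOn (G x.1 (x.2.1 + 1) (insert c (seenColors x.2.2))) fun u =>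
      if u.1 = s then endValue g₀ G x.1 else 0

/-- The potential of the memory, given by the values `G` at the beginnings of the samples, the
value `g₀` of the answer `⊥`, and the value `κ` of every step. -/
noncomputable def potential : Memory → ℝ
  | .halt a => a.elim g₀ fun _ => 0
  | .check r o => κ * o.elim 2 (fun _ => 1) + G r 0 ∅
  | .toss x => G x.1 x.2.1 (seenColors x.2.2)
  | .visit x w => κ * (2 * w.2 + 1) + ((T w.1.1).subtreeAt w.1.2).elim 0 fun S =>
      S.walkMean (outcomeValue g₀ G x w.1.1) w.2
  | .branch x w _ => κ * (2 * w.2 + 2) + ((T w.1.1).subtreeAt w.1.2).elim 0 fun S =>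
      S.walkMean (outcomeValue g₀ G x w.1.1) (w.2 + 1)

/-- The expected value of a sample does not exceed the value before it. -/
structure IsPotential : Prop where
  step_nonneg : 0 ≤ κ
  none_nonneg : 0 ≤ g₀
  nonneg : ∀ r t K, 0 ≤ G r t K
  sample_le : ∀ r t L, κ + ((∑ s, (T s).walkMean (outcomeValue g₀ G (r, t, L) s) (walkBound t)) / 2
    + κ * (2 * walkBound t + 1)) ≤ G r t (seenColors L)
  roots_le : ∀ r, potential T κ g₀ G (checkRoots r (T 0).rootInfo (T 1).rootInfo) ≤ G r 0 ∅

variable {T κ g₀ G}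

theorem IsPotential.outcomeValue_nonneg (h : IsPotential T κ g₀ G) (x : Progress) (s : Fin 2)
    (o : Option ℕ) : 0 ≤ outcomeValue g₀ G x s o := by
  rcases o with _ | c
  · exact h.nonneg _ _ _
  · simp only [outcomeValue]
    rcases lookup x.2.2 c with _ | u
    · exact h.nonneg _ _ _
    · simp only
      split_ifs
      · rcases x.1 with _ | r
        exacts [h.none_nonneg, h.nonneg _ _ _]
      · rfl

theorem IsPotential.potential_nonneg (h : IsPotential T κ g₀ G) (m : Memory) :
    0 ≤ potential T κ g₀ G m := by
  have := h.step_nonneg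
  have elim_nonneg (o : Option SearchTree) (x : Progress) (s : Fin 2) (D : ℕ) :
      0 ≤ o.elim 0 fun S => S.walkMean (outcomeValue g₀ G x s) D := by
    rcases o with _ | S
    exacts [le_rfl, walkMean_nonneg (h.outcomeValue_nonneg x s) S D]
  rcases m with (_ | a) | ⟨r, _ | i⟩ | x | ⟨x, w⟩ | ⟨x, w, d⟩
  · exact h.none_nonneg
  · exact le_rfl
  · exact add_nonneg (mul_nonneg this zero_le_two) (h.nonneg _ _ _)
  · exact add_nonneg (mul_nonneg this zero_le_one) (h.nonneg _ _ _)
  · exact h.nonneg _ _ _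
  · exact add_nonneg (by positivity) (elim_nonneg ..)
  · exact add_nonneg (by positivity) (elim_nonneg ..)

theorem potential_reachLeaf (x : Progress) (v : Fin 2 × List ℕ) (c : ℕ) :
    potential T κ g₀ G (reachLeaf x v c) = outcomeValue g₀ G x v.1 (some c) := by
  rcases h : lookup x.2.2 c with _ | u
  · simp [reachLeaf, outcomeValue, h, potential, seenColors_cons]
  · simp only [reachLeaf, outcomeValue, h]
    split_ifs
    · rcases x.1 with _ | r <;> rfl
    · simp only [potential, crossAnswer]
      split_ifs <;> rfl

theorem cost_request_le (c : algorithm.Config) (s : Fin 2) (p : List ℕ) :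
    (algorithm.request T c s p).cost ≤ c.cost + 1 := by
  rw [request]
  split_ifs
  · simp only [Config.cost, Finset.filter_insert]
    split_ifs
    · exact Finset.card_insert_le _ _
    · exact Nat.le_succ _
  · exact Nat.le_succ _

/-- A walk with `f` moves left takes at most `f + 1` requests and `f` draws, which explains the
factor `2 * f + 1` in `potential`; the walk itself contributes the expected value of its outcome. -/
theorem IsPotential.request_le (h : IsPotential T κ g₀ G) {c : algorithm.Config}
    (hc : Consistent T c) {s : Fin 2} {p : List ℕ} (hact : algorithm.act c.mem = .inl (s, p)) :
    potential T κ g₀ G (algorithm.request T c s p).mem + κ ≤ potential T κ g₀ G c.mem := by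
  obtain ⟨m, X⟩ := c
  obtain ⟨hr, hm⟩ := hc
  rcases m with a | ⟨r, o⟩ | x | ⟨x, w⟩ | ⟨x, w, d⟩ <;>
    simp only [algorithm, action, reduceCtorEq, Sum.inl.injEq] at hact
  · cases hact
    rw [request_eq (hr _) (subtreeAt_nil _)]
    rcases o with _ | i
    · simp only [onReply, potential, Option.elim_some, Option.elim_none]
      linarith
    · obtain rfl : i = (T 0).rootInfo := hm i rfl
      have := h.roots_le r
      simp only [onReply, potential, Option.elim_some] at this ⊢
      linarith
  · obtain ⟨⟨s', p'⟩, f⟩ := w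
    cases hact
    obtain ⟨hx, hp, S, hS⟩ := hm
    rw [request_eq hp hS]
    have := mul_nonneg h.step_nonneg (Nat.cast_nonneg (α := ℝ) f)
    cases S with
    | leaf c =>
      change potential T κ g₀ G (reachLeaf x (s, p) c) + κ ≤ _
      rw [potential_reachLeaf]
      simp only [potential, hS, Option.elim_some, walkMean]
      linarith
    | node k child =>
      cases f with
      | zero =>
        simp only [onReply, rootInfo, reachNode, potential, hS, Option.elim_some, walkMean,
          outcomeValue, Nat.cast_zero]
        linarith
      | succ f =>
        simp only [onReply, rootInfo, reachNode, potential, hS, Option.elim_some]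
        push_cast
        linarith

theorem IsPotential.draw_le (h : IsPotential T κ g₀ G) {c : algorithm.Config}
    (hc : Consistent T c) {n : ℕ} (hact : algorithm.act c.mem = .inr (.inl n)) :
    (∑ k : Fin (n + 1), potential T κ g₀ G (algorithm.afterDraw c.mem k)) / (n + 1) + κ ≤
      potential T κ g₀ G c.mem := by
  obtain ⟨m, X⟩ := c
  obtain ⟨hr, hm⟩ := hc
  rcases m with a | ⟨r, o⟩ | x | ⟨x, w⟩ | ⟨x, w, d⟩ <;>
    simp only [algorithm, action, reduceCtorEq, Sum.inr.injEq, Sum.inl.injEq] at hact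
  · subst hact
    obtain ⟨r, t, L⟩ := x
    have := h.sample_le r t L
    simp only [Fin.sum_univ_two] at this
    change (∑ k : Fin 2, potential T κ g₀ G (onDraw k (.toss (r, t, L)))) / ((1 : ℕ) + 1) + κ ≤ _
    simp only [Fin.sum_univ_two, onDraw, potential, subtreeAt_nil, Option.elim_some,
      Nat.cast_one, Fin.val_zero, Fin.val_one, if_true, one_ne_zero, if_false]
    linarith
  · obtain ⟨hx, hp, k, child, hS, rfl⟩ := hm
    subst hact
    have hk : ((k : ℝ) + 2) ≠ 0 := by positivity
    simp only [algorithm, onDraw, potential, hS, Option.elim_some, walkMean, Nat.pred_succ]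
    have : ∀ i : Fin (k + 1 + 1),
        ((T w.1.1).subtreeAt (w.1.2 ++ [i.1])).elim 0 (fun S =>
          S.walkMean (outcomeValue g₀ G x w.1.1) w.2) =
        (child i).walkMean (outcomeValue g₀ G x w.1.1) w.2 := fun i => by
      rw [subtreeAt_child hS i, Option.elim_some]
    simp only [this, Finset.sum_add_distrib, Finset.sum_const, Finset.card_univ, Fintype.card_fin,
      nsmul_eq_mul]
    push_cast
    rw [show (k : ℝ) + 1 + 1 = k + 2 by ring, add_div, mul_div_cancel_left₀ _ hk]
    linarith

open Classical in
/-- The potential bounds the expected value of the final answer together with the expected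
cost and the expected number of steps, if at most `κ` is charged for the two. -/
theorem IsPotential.runMean_le (h : IsPotential T κ g₀ G) {a b : ℝ} (ha : 0 ≤ a) (hb : 0 ≤ b)
    (hab : a + b ≤ κ) (ε : ℝ) (n : ℕ) :
    algorithm.runMean T ε n (fun c => ENNReal.ofReal (a * c.cost + potential T κ g₀ G c.mem)) +
      ∑ j ∈ Finset.range n, algorithm.runMean T ε j
        (fun c => ENNReal.ofReal (if IsActive c then b else 0)) ≤
      ENNReal.ofReal (potential T κ g₀ G (algorithm.initial ε).mem) := by
  -- Only the roots are explored at the start, so the initial cost is 0.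
  have h0 : potential T κ g₀ G (algorithm.initial ε).mem =
      a * (algorithm.initial ε).cost + potential T κ g₀ G (algorithm.initial ε).mem := by
    simp [initial, Config.cost, Finset.filter_insert, Finset.filter_singleton]
  rw [h0]
  refine runMean_add_sum_le (isInvariant_consistent (T := T)) (consistent_initial ε)
    (g := fun c => ENNReal.ofReal (a * c.cost + potential T κ g₀ G c.mem)) (fun c hc => ?_) n
  refine stepMean_ofReal_le
    (G := fun c : algorithm.Config => a * c.cost + potential T κ g₀ G c.mem)
    (fun c => add_nonneg (by positivity) (h.potential_nonneg _)) (by split_ifs <;> simp [hb])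
    ?_ ?_ ?_
  · intro s p hact
    have hcost : ((algorithm.request T c s p).cost : ℝ) ≤ c.cost + 1 := by
      exact_mod_cast cost_request_le c s p
    have := h.request_le hc hact
    have := mul_le_mul_of_nonneg_left hcost ha
    have : IsActive c := fun r hr => by simp [hact] at hr
    rw [if_pos this]
    linarith
  · intro m hact
    have := h.draw_le hc hact
    have hm : ((m : ℝ) + 1) ≠ 0 := by positivity
    have : IsActive c := fun r hr => by simp [hact] at hr
    rw [if_pos this]
    simp only [Finset.sum_add_distrib, Finset.sum_const, Finset.card_univ, Fintype.card_fin,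
      nsmul_eq_mul, Config.cost]
    push_cast
    rw [add_div, mul_div_cancel_left₀ _ hm]
    linarith
  · intro r hact
    exact if_neg fun hc => hc r hact

end Potential

end CollisionSearch

namespace CollisionSearch

open SearchTree ExplorationAlgorithm

/-! ### The probability of failure -/

/-- The first collision of a run is as likely to be within one tree as between the trees. -/
theorem isPotential_failure {T : Fin 2 → SearchTree} {φ : (T 0).Vertex ≃ (T 1).Vertex}
    (hφ : IsColorIso φ) {ψ : (T 1).Vertex ≃ (T 0).Vertex} (hψ : IsColorIso ψ) :
    IsPotential T 0 1 fun r _ _ => (1 / 2) ^ (r + 1) where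
  step_nonneg := le_rfl
  none_nonneg := zero_le_one
  nonneg r _ _ := by positivity
  sample_le r t L := by
    have hend : endValue 1 (fun r _ _ => (1 / 2) ^ (r + 1)) r = ((1 / 2) ^ r : ℝ) := by
      cases r <;> simp [endValue]
    -- Without a collision each tree contributes `(1/2) ^ (r + 1)`. With a collision, the tree of
    -- the stored leaf contributes `(1/2) ^ r` (failed run) and the other one 0 (success). The sum
    -- is the same.
    have hsum (o : Option ℕ) : outcomeValue 1 (fun r _ _ => (1 / 2) ^ (r + 1)) (r, t, L) 0 o +
        outcomeValue 1 (fun r _ _ => (1 / 2) ^ (r + 1)) (r, t, L) 1 o = ((1 / 2) ^ r : ℝ) := by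
      have h2 : ((1 / 2) ^ (r + 1) : ℝ) + (1 / 2) ^ (r + 1) = (1 / 2) ^ r := by ring
      rcases o with _ | c
      · exact h2
      · rcases hc : lookup L c with _ | ⟨s, p⟩
        · simpa only [outcomeValue, hc] using h2
        · simp only [outcomeValue, hc, hend]
          fin_cases s <;> simp
    -- Isomorphism turns the walk in the second tree into a walk in the first, so that outcomes can
    -- be added pointwise.
    rw [Fin.sum_univ_two, ← hφ.walkMean_eq, ← walkMean_add]
    simp only [hsum, walkMean_const]
    exact le_of_eq (by ring)
  roots_le r := by
    -- Both directions are needed to exclude that exactly one root is a leaf; two leaf roots have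
    -- equal colours.
    have h0 := hφ.rootInfo_eq_leaf
    have h1 := hψ.rootInfo_eq_leaf
    rcases h : (T 0).rootInfo with c | d <;> rcases h' : (T 1).rootInfo with c' | d'
    · have := h0 c h
      rw [h'] at this
      cases this
      simp [checkRoots, potential]
    · simp [h0 c h] at h'
    · simp [h1 c' h'] at h
    · simp [checkRoots, potential]

/-! ### The expected cost -/

theorem lt_two_pow_bitLength (t : ℕ) : t < 2 ^ bitLength t := by
  induction t with
  | zero => simp [bitLength]
  | succ t ih =>
    change t + 1 < 2 ^ (if 2 ^ bitLength t ≤ t + 1 then bitLength t + 1 else bitLength t)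
    split_ifs with h
    · rw [pow_succ]; omega
    · omega

theorem two_pow_bitLength_le {t : ℕ} (ht : 1 ≤ t) : 2 ^ bitLength t ≤ 2 * t := by
  induction t, ht using Nat.le_induction with
  | base => simp [bitLength]
  | succ t ht ih =>
    change 2 ^ (if 2 ^ bitLength t ≤ t + 1 then bitLength t + 1 else bitLength t) ≤ 2 * (t + 1)
    split_ifs with h
    · rw [pow_succ]; omega
    · omega

theorem monotone_bitLength : Monotone bitLength := by
  refine monotone_nat_of_le_succ fun t => ?_
  change bitLength t ≤ if 2 ^ bitLength t ≤ t + 1 then bitLength t + 1 else bitLength t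
  split_ifs <;> omega

theorem bitLength_le_logb {t : ℕ} (ht : 1 ≤ t) : (bitLength t : ℝ) ≤ 1 + Real.logb 2 t := by
  have ht' : (0 : ℝ) < t := by exact_mod_cast ht
  have h : ((2 : ℝ) ^ (bitLength t : ℝ)) ≤ 2 * t := by
    rw [Real.rpow_natCast]
    exact_mod_cast two_pow_bitLength_le ht
  have h' := (Real.le_logb_iff_rpow_le one_lt_two (by positivity)).2 h
  rwa [Real.logb_mul two_ne_zero ht'.ne', Real.logb_self_eq_one one_lt_two] at h'

/-- If the mass of the seen colours is `a`, then the expected decrease of `1 / (a + s)` caused by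
a sample is bounded from below. -/
theorem one_div_twelve_le_drift {S K : Finset ℕ} {q : ℕ → ℝ} (hq : ∀ c, 0 ≤ q c)
    (h1 : 1 / 2 ≤ ∑ c ∈ S, q c) (h2 : ∑ c ∈ S, q c ≤ 1) {x : ℝ} (hx : 1 ≤ x)
    (hcard : (S.card : ℝ) ≤ x ^ 2) {a s : ℝ} (ha : a = ∑ c ∈ S with c ∈ K, q c)
    (hs : s = 1 / (4 * x)) :
    1 / 12 ≤ ∑ c ∈ S, (if c ∈ K then 1 / (a + s) else 1 / (a + s) - 1 / (a + q c + s)) * q c := by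
  have hs0 : 0 < s := by rw [hs]; positivity
  have hs4 : s ≤ 1 / 4 := by
    rw [hs]; exact one_div_le_one_div_of_le (by norm_num) (by linarith)
  have ha0 : 0 ≤ a := ha ▸ Finset.sum_nonneg fun c _ => hq c
  have hsplit : ∑ c ∈ S, (if c ∈ K then 1 / (a + s) else 1 / (a + s) - 1 / (a + q c + s)) * q c =
      1 / (a + s) * a + ∑ c ∈ S with c ∉ K, (1 / (a + s) - 1 / (a + q c + s)) * q c := by
    rw [← Finset.sum_filter_add_sum_filter_not S (· ∈ K)]
    congr 1
    · rw [ha, Finset.mul_sum]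
      exact Finset.sum_congr rfl fun c hc => by rw [if_pos (Finset.mem_filter.1 hc).2]
    · exact Finset.sum_congr rfl fun c hc => by rw [if_neg (Finset.mem_filter.1 hc).2]
  rw [hsplit]
  have hterm (c : ℕ) : (1 / (a + s) - 1 / (a + q c + s)) * q c =
      q c ^ 2 / ((a + s) * (a + q c + s)) := by
    have := hq c
    have : a + s ≠ 0 := by positivity
    have : a + q c + s ≠ 0 := by positivity
    field_simp
    ring
  simp only [hterm]
  have hnn : 0 ≤ ∑ c ∈ S with c ∉ K, q c ^ 2 / ((a + s) * (a + q c + s)) :=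
    Finset.sum_nonneg fun c _ => by have := hq c; positivity
  -- For `s ≤ a`, repeated colours alone contribute `a / (a + s) ≥ 1 / 2`. For `a < s ≤ 1 / 4`,
  -- unseen colours have mass `R ≥ 1 / 4`, and Cauchy–Schwarz shows that they increase the seen mass
  -- enough.
  rcases le_or_gt s a with has | has
  · have : 1 / 2 ≤ 1 / (a + s) * a := by
      rw [one_div_mul_eq_div, le_div_iff₀ (by positivity)]
      linarith
    linarith
  · set R := ∑ c ∈ S with c ∉ K, q c with hR
    have hRa : a + R = ∑ c ∈ S, q c := by
      rw [ha, hR, Finset.sum_filter_add_sum_filter_not]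
    have hR4 : 1 / 4 ≤ R := by linarith
    have hR1 : R ≤ 1 := by linarith
    have hcard' : (({c ∈ S | c ∉ K}.card : ℕ) : ℝ) ≤ x ^ 2 :=
      le_trans (by exact_mod_cast Finset.card_filter_le _ _) hcard
    -- At most `x ^ 2` colours contribute `2 * s = 1 / (2 * x)` each, and `R ≤ 1 ≤ x`.
    have hden : ∑ c ∈ S with c ∉ K, (2 * s + q c) ≤ 3 / 2 * x := by
      rw [Finset.sum_add_distrib, Finset.sum_const, nsmul_eq_mul, ← hR]
      have h3 := mul_le_mul_of_nonneg_right hcard' (by positivity : 0 ≤ 2 * s)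
      have h4 : x ^ 2 * (2 * s) = x / 2 := by rw [hs]; field_simp; ring
      linarith
    have hden0 : 0 < ∑ c ∈ S with c ∉ K, (2 * s + q c) := by
      rw [Finset.sum_add_distrib, Finset.sum_const, nsmul_eq_mul]
      positivity
    have hCS : R ^ 2 / ∑ c ∈ S with c ∉ K, (2 * s + q c) ≤
        ∑ c ∈ S with c ∉ K, q c ^ 2 / (2 * s + q c) :=
      Finset.sq_sum_div_le_sum_sq_div _ q fun c _ => by have := hq c; positivity
    have hlow : 1 / (24 * x) ≤ R ^ 2 / ∑ c ∈ S with c ∉ K, (2 * s + q c) := by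
      calc 1 / (24 * x) = (1 / 4) ^ 2 / (3 / 2 * x) := by field_simp; norm_num
        _ ≤ _ := by gcongr
    have hle : 1 / (2 * s) * ∑ c ∈ S with c ∉ K, q c ^ 2 / (2 * s + q c) ≤
        ∑ c ∈ S with c ∉ K, q c ^ 2 / ((a + s) * (a + q c + s)) := by
      rw [Finset.mul_sum]
      refine Finset.sum_le_sum fun c _ => ?_
      have := hq c
      rw [one_div_mul_eq_div, div_div, mul_comm (2 * s + q c)]
      exact div_le_div_of_nonneg_left (by positivity) (by positivity)
        (mul_le_mul (by linarith) (by linarith) (by positivity) (by positivity))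
    have : 1 / 12 ≤ 1 / (2 * s) * ∑ c ∈ S with c ∉ K, q c ^ 2 / (2 * s + q c) := by
      calc (1 / 12 : ℝ) = 1 / (2 * s) * (1 / (24 * x)) := by rw [hs]; field_simp; norm_num
        _ ≤ _ := by gcongr; exact hlow.trans hCS
    have : 0 ≤ 1 / (a + s) * a := by positivity
    linarith

/-! ### Colour probabilities and the cost potential of a run. -/

section Cost

/-- The probability that a random walk reaches a leaf of colour `c`. -/
noncomputable def hitProb (S : SearchTree) (D : ℕ) (c : ℕ) : ℝ :=
  S.walkMean (fun x => if x = some c then 1 else 0) D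

theorem hitProb_nonneg (S : SearchTree) (D : ℕ) (c : ℕ) : 0 ≤ hitProb S D c :=
  walkMean_nonneg (fun x => by split_ifs <;> simp) S D

theorem walkMean_eq_sum (S : SearchTree) (D : ℕ) {f : Option ℕ → ℝ} (hf : f none = 0) :
    S.walkMean f D = ∑ c ∈ S.colors, f (some c) * hitProb S D c := by
  simp only [hitProb, ← walkMean_const_mul]
  rw [← walkMean_sum]
  refine walkMean_congr S (fun c hc => ?_) (by simp [hf]) D
  simp [hc]

theorem sum_hitProb_le_one (S : SearchTree) (D : ℕ) : ∑ c ∈ S.colors, hitProb S D c ≤ 1 := by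
  have h := walkMean_eq_sum S D (f := fun x => if x = none then 0 else 1) rfl
  simp only [reduceCtorEq, if_false, one_mul] at h
  rw [← h]
  refine (walkMean_mono (fun x => ?_) S D).trans_eq (walkMean_const 1 S D)
  split_ifs <;> norm_num

theorem half_le_sum_hitProb (S : SearchTree) {D : ℕ} (hD : 2 * S.size ≤ 2 ^ D) :
    1 / 2 ≤ ∑ c ∈ S.colors, hitProb S D c := by
  have h := walkMean_eq_sum S D (f := fun x => if x = none then 0 else 1) rfl
  simp only [reduceCtorEq, if_false, one_mul] at h
  have h1 : S.walkMean (fun x => (if x = none then 1 else 0) + if x = none then 0 else 1) D = 1 :=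
    (congrArg (fun f => S.walkMean f D) (funext fun x => by split_ifs <;> simp)).trans
      (walkMean_const 1 S D)
  rw [walkMean_add, h] at h1
  have h2 : (S.size : ℝ) / 2 ^ D ≤ 1 / 2 := by
    rw [div_le_div_iff₀ (by positivity) two_pos]
    exact_mod_cast (by omega : S.size * 2 ≤ 1 * 2 ^ D)
  linarith [walkMean_none_le S D]

variable (S : SearchTree)

/-- The square root of the size, rounded up. -/
noncomputable def sqrtSize : ℕ := ⌈√(S.size : ℝ)⌉₊

/-- A number of samples after which the random walks are long enough. -/
noncomputable def warmUp : ℕ := 192 * sqrtSize S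

/-- A bound on the number of steps of each of the first samples. -/
noncomputable def sampleCost : ℝ := 8 + 4 * Real.logb 2 (warmUp S)

/-- The mass of the colours in `K` plus a constant. -/
noncomputable def seenMass (K : Finset ℕ) : ℝ :=
  -- The walk length is frozen, so the mass depends on `K` only and not on the number of samples.
  ∑ c ∈ S.colors with c ∈ K, hitProb S (walkBound (warmUp S)) c + 1 / (4 * sqrtSize S)

/-- A bound on the expected number of steps until the end of the run, after `t` samples that have
seen the colours in `K`. -/
noncomputable def runCost (t : ℕ) (K : Finset ℕ) : ℝ :=
  -- One half of the initial value pays for the warm-up, the other half for the second phase.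
  if t < warmUp S then (2 * warmUp S - t) * sampleCost S
  -- The drift `1 / 12` times 48, halved by the coin, gives two units: one pays for the steps of the
  -- sample, the other for the growth of `t / warmUp S`.
  else 48 * (sampleCost S * (t / warmUp S)) * (1 / seenMass S K)

theorem one_le_sqrtSize : 1 ≤ sqrtSize S :=
  Nat.one_le_ceil_iff.2 (Real.sqrt_pos.2 (by exact_mod_cast S.one_le_size))

theorem size_le_sq_sqrtSize : S.size ≤ sqrtSize S ^ 2 := by
  have h : √(S.size : ℝ) ≤ sqrtSize S := Nat.le_ceil _
  have := (Real.sqrt_le_left (by positivity)).1 h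
  exact_mod_cast this

theorem one_le_warmUp : 1 ≤ warmUp S := by
  have := one_le_sqrtSize S
  rw [warmUp]; omega

/-- This is why `walkBound` is twice the bit length: walks must be long compared with `log₂ |S|`
after only about `√|S|` samples. -/
theorem two_mul_size_le : 2 * S.size ≤ 2 ^ walkBound (warmUp S) := by
  have h1 := size_le_sq_sqrtSize S
  have h2 := lt_two_pow_bitLength (warmUp S)
  have h3 : 2 * sqrtSize S ≤ 2 ^ bitLength (warmUp S) := by rw [warmUp] at *; omega
  rw [walkBound, pow_add]
  calc 2 * S.size ≤ (2 * sqrtSize S) * (2 * sqrtSize S) := by nlinarith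
    _ ≤ _ := Nat.mul_le_mul h3 h3

theorem eight_le_sampleCost : 8 ≤ sampleCost S := by
  have : 0 ≤ Real.logb 2 (warmUp S) :=
    Real.logb_nonneg one_lt_two (by exact_mod_cast one_le_warmUp S)
  rw [sampleCost]; linarith

theorem step_count_le {t : ℕ} (ht : t ≤ warmUp S) :
    1 + (2 * (walkBound t : ℝ) + 1) ≤ sampleCost S := by
  have h1 : (bitLength t : ℝ) ≤ bitLength (warmUp S) := by exact_mod_cast monotone_bitLength ht
  have h2 := bitLength_le_logb (one_le_warmUp S)
  rw [walkBound, sampleCost]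
  push_cast
  linarith

/-- The logarithmic growth of the walks is replaced by a linear one, whose increments are constant.
-/
theorem step_count_le_of_le {t : ℕ} (ht : warmUp S ≤ t) :
    1 + (2 * (walkBound t : ℝ) + 1) ≤ sampleCost S * (t / warmUp S) := by
  have hw : (1 : ℝ) ≤ warmUp S := by exact_mod_cast one_le_warmUp S
  have ht' : (warmUp S : ℝ) ≤ t := by exact_mod_cast ht
  have hx : 1 ≤ (t : ℝ) / warmUp S := by rwa [one_le_div (by linarith)]
  have h2 := bitLength_le_logb ((one_le_warmUp S).trans ht)
  have h3 : Real.logb 2 t = Real.logb 2 (warmUp S) + Real.logb 2 (t / warmUp S) := by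
    rw [← Real.logb_mul (by positivity) (by positivity), mul_div_cancel₀]
    positivity
  -- The factor 2 suffices because `log 2 > 1 / 2`.
  have h4 : Real.logb 2 (t / warmUp S) ≤ 2 * (t / warmUp S - 1) := by
    rw [Real.logb, div_le_iff₀ (Real.log_pos one_lt_two)]
    have := Real.log_le_sub_one_of_pos (by linarith : 0 < (t : ℝ) / warmUp S)
    nlinarith [Real.log_two_gt_d9]
  have h5 : 0 ≤ Real.logb 2 (warmUp S) := Real.logb_nonneg one_lt_two hw
  rw [walkBound, sampleCost]
  push_cast
  nlinarith [mul_le_mul_of_nonneg_left hx h5]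

theorem seenMass_pos (K : Finset ℕ) : 0 < seenMass S K := by
  have := one_le_sqrtSize S
  exact add_pos_of_nonneg_of_pos (Finset.sum_nonneg fun c _ => hitProb_nonneg ..) (by positivity)

theorem one_div_seenMass_le (K : Finset ℕ) : 1 / seenMass S K ≤ 4 * sqrtSize S := by
  have := one_le_sqrtSize S
  rw [one_div_le (seenMass_pos S K) (by positivity)]
  exact le_add_of_nonneg_left (Finset.sum_nonneg fun c _ => hitProb_nonneg ..)

theorem seenMass_insert {c : ℕ} {K : Finset ℕ} (hc : c ∈ S.colors) (hK : c ∉ K) :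
    seenMass S (insert c K) = ∑ c ∈ S.colors with c ∈ K, hitProb S (walkBound (warmUp S)) c +
      hitProb S (walkBound (warmUp S)) c + 1 / (4 * sqrtSize S) := by
  have : S.colors.filter (· ∈ insert c K) = insert c (S.colors.filter (· ∈ K)) := by
    ext d
    simp only [Finset.mem_filter, Finset.mem_insert]
    constructor
    · rintro ⟨h, rfl | h'⟩
      exacts [.inl rfl, .inr ⟨h, h'⟩]
    · rintro (rfl | ⟨h, h'⟩)
      exacts [⟨hc, .inl rfl⟩, ⟨h, .inr h'⟩]
  rw [seenMass, this, Finset.sum_insert (by simp [hK]), add_comm (hitProb _ _ _)]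

theorem seenMass_le_insert (c : ℕ) (K : Finset ℕ) : seenMass S K ≤ seenMass S (insert c K) := by
  rw [seenMass, seenMass]
  gcongr ?_ + _
  refine Finset.sum_le_sum_of_subset_of_nonneg (fun d hd => ?_) fun d _ _ => hitProb_nonneg ..
  simp only [Finset.mem_filter, Finset.mem_insert] at hd ⊢
  exact ⟨hd.1, .inr hd.2⟩

theorem runCost_nonneg (t : ℕ) (K : Finset ℕ) : 0 ≤ runCost S t K := by
  have := eight_le_sampleCost S
  have := seenMass_pos S K
  rw [runCost]
  split_ifs with h
  · have : (t : ℝ) ≤ warmUp S := by exact_mod_cast h.le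
    exact mul_nonneg (by linarith) (by linarith)
  · positivity

theorem runCost_insert_le (t : ℕ) (c : ℕ) (K : Finset ℕ) :
    runCost S t (insert c K) ≤ runCost S t K := by
  have := eight_le_sampleCost S
  have := seenMass_pos S K
  have := seenMass_le_insert S c K
  rw [runCost, runCost]
  split_ifs
  · rfl
  · gcongr

theorem runCost_zero (K : Finset ℕ) : runCost S 0 K = 2 * warmUp S * sampleCost S := by
  rw [runCost, if_pos (Nat.pos_of_ne_zero (Nat.one_le_iff_ne_zero.1 (one_le_warmUp S)))]
  simp

/-- The phases fit together at `t + 1 = warmUp S`: the second formula is at most `48 * 4 * sqrtSize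
S = warmUp S` times `sampleCost S`. This is the origin of 192. -/
theorem runCost_succ_le {t : ℕ} (ht : t < warmUp S) (K : Finset ℕ) :
    runCost S (t + 1) K ≤ (2 * warmUp S - t - 1) * sampleCost S := by
  have hb := eight_le_sampleCost S
  rw [runCost]
  split_ifs with h
  · push_cast
    exact le_of_eq (by ring)
  · obtain h : t + 1 = warmUp S := by omega
    have hw : (1 : ℝ) ≤ warmUp S := by exact_mod_cast one_le_warmUp S
    rw [h, div_self (by positivity)]
    have h1 := one_div_seenMass_le S K
    have h2 : (t : ℝ) + 1 = warmUp S := by exact_mod_cast h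
    have h3 : (warmUp S : ℝ) = 192 * sqrtSize S := by rw [warmUp]; push_cast; ring
    have h4 := mul_le_mul_of_nonneg_left h1 (by linarith : 0 ≤ sampleCost S)
    have h5 : (2 * warmUp S - t - 1 : ℝ) = 192 * sqrtSize S := by linarith
    rw [h5]
    linarith

/-- The potential after a sample, if the run does not end with a collision. -/
noncomputable def sampleValue (t : ℕ) (K : Finset ℕ) : Option ℕ → ℝ
  | none => runCost S (t + 1) K
  | some c => if c ∈ K then 0 else runCost S (t + 1) (insert c K)

theorem sampleValue_le (t : ℕ) (K : Finset ℕ) (o : Option ℕ) :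
    sampleValue S t K o ≤ runCost S (t + 1) K := by
  rcases o with _ | c
  · rfl
  · rw [sampleValue]
    split_ifs
    exacts [runCost_nonneg .., runCost_insert_le ..]

theorem walkMean_sampleValue_le {t : ℕ} (ht : warmUp S ≤ t) (K : Finset ℕ) :
    S.walkMean (sampleValue S t K) (walkBound t) ≤
      runCost S (t + 1) K - 4 * (sampleCost S * ((t + 1 : ℕ) / warmUp S)) := by
  set B := sampleCost S * ((t + 1 : ℕ) / warmUp S) with hB
  have hB0 : 0 ≤ B := by have := eight_le_sampleCost S; positivity
  set f : Option ℕ → ℝ := fun o => runCost S (t + 1) K - sampleValue S t K o with hf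
  have hf0 (o : Option ℕ) : 0 ≤ f o := sub_nonneg.2 (sampleValue_le S t K o)
  have hfn : f none = 0 := sub_self _
  have hsum : S.walkMean (sampleValue S t K) (walkBound t) + S.walkMean f (walkBound t) =
      runCost S (t + 1) K := by
    rw [← walkMean_add, ← walkMean_const (runCost S (t + 1) K) S (walkBound t)]
    exact congrArg (fun f => S.walkMean f _) (funext fun o => by simp [hf])
  -- The decrease `f` is nonnegative and vanishes at `none`, so walks longer than the frozen length
  -- only help.
  have hmono : S.walkMean f (walkBound (warmUp S)) ≤ S.walkMean f (walkBound t) :=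
    walkMean_le_walkMean hf0 hfn S
      (add_le_add (monotone_bitLength ht) (monotone_bitLength ht))
  have hdrift := one_div_twelve_le_drift (S := S.colors) (K := K)
    (q := hitProb S (walkBound (warmUp S))) (hitProb_nonneg _ _)
    (half_le_sum_hitProb S (two_mul_size_le S)) (sum_hitProb_le_one _ _)
    (x := sqrtSize S) (by exact_mod_cast one_le_sqrtSize S)
    (by exact_mod_cast S.card_colors_le_size.trans (size_le_sq_sqrtSize S)) rfl rfl
  have hval : S.walkMean f (walkBound (warmUp S)) = 48 * B * ∑ c ∈ S.colors, (if c ∈ K then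
        1 / (∑ c ∈ S.colors with c ∈ K, hitProb S (walkBound (warmUp S)) c +
          1 / (4 * (sqrtSize S : ℝ)))
      else 1 / (∑ c ∈ S.colors with c ∈ K, hitProb S (walkBound (warmUp S)) c +
          1 / (4 * (sqrtSize S : ℝ))) -
        1 / (∑ c ∈ S.colors with c ∈ K, hitProb S (walkBound (warmUp S)) c +
          hitProb S (walkBound (warmUp S)) c + 1 / (4 * (sqrtSize S : ℝ)))) *
      hitProb S (walkBound (warmUp S)) c := by
    rw [walkMean_eq_sum S _ hfn, Finset.mul_sum]
    refine Finset.sum_congr rfl fun c hc => ?_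
    have hlt : ¬ t + 1 < warmUp S := by omega
    rw [← mul_assoc]
    congr 1
    simp only [hf, sampleValue]
    split_ifs with h
    · rw [runCost, if_neg hlt, ← hB, seenMass, sub_zero]
    · rw [runCost, runCost, if_neg hlt, if_neg hlt, ← hB, seenMass_insert S hc h, seenMass,
        mul_sub]
  have := mul_le_mul_of_nonneg_left hdrift (by positivity : 0 ≤ 48 * B)
  rw [← hval] at this
  linarith

/-- Only samples from `T i` need to make progress. For the other tree `sampleValue_le` is enough:
new colours never decrease the mass, and collisions have value 0. -/
theorem runCost_sample_le (T : Fin 2 → SearchTree) (i : Fin 2) (t : ℕ) (K : Finset ℕ) :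
    1 + ((∑ s, (T s).walkMean (sampleValue (T i) t K) (walkBound t)) / 2 +
      1 * (2 * walkBound t + 1)) ≤ runCost (T i) t K := by
  have hle (s : Fin 2) : (T s).walkMean (sampleValue (T i) t K) (walkBound t) ≤
      runCost (T i) (t + 1) K :=
    (walkMean_mono (sampleValue_le (T i) t K) _ _).trans_eq (walkMean_const _ _ _)
  rw [Fin.sum_univ_two]
  rcases lt_or_ge t (warmUp (T i)) with ht | ht
  · have h1 := runCost_succ_le (T i) ht K
    have h2 := step_count_le (T i) ht.le
    have h0 := hle 0
    have h0' := hle 1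
    rw [runCost, if_pos ht]
    linarith
  · have h1 : (T 0).walkMean (sampleValue (T i) t K) (walkBound t) +
        (T 1).walkMean (sampleValue (T i) t K) (walkBound t) ≤
        2 * runCost (T i) (t + 1) K - 4 * (sampleCost (T i) * ((t + 1 : ℕ) / warmUp (T i))) := by
      have h := walkMean_sampleValue_le (T i) ht K
      have h0 := hle 0
      have h0' := hle 1
      obtain rfl | rfl : i = 0 ∨ i = 1 := by omega
      all_goals linarith
    set b := sampleCost (T i)
    have hb : 8 ≤ b := eight_le_sampleCost (T i)
    have h2 := step_count_le_of_le (T i) ht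
    have hw : (1 : ℝ) ≤ warmUp (T i) := by exact_mod_cast one_le_warmUp (T i)
    have hwt : (warmUp (T i) : ℝ) ≤ t := by exact_mod_cast ht
    have hU := one_div_seenMass_le (T i) K
    rw [runCost, if_neg (by omega)] at h1
    rw [runCost, if_neg (by omega)]
    set U := 1 / seenMass (T i) K
    have h3 : b * ((t + 1 : ℕ) / warmUp (T i)) = b * (t / warmUp (T i)) + b / warmUp (T i) := by
      push_cast
      ring
    -- The price of increasing `t` by one in the prefactor, by `U ≤ 4 * sqrtSize (T i)`.
    have h4 : 48 * (b / warmUp (T i)) * U ≤ b := by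
      have hm : (1 : ℝ) ≤ sqrtSize (T i) := by exact_mod_cast one_le_sqrtSize (T i)
      have hwm : (warmUp (T i) : ℝ) = 192 * sqrtSize (T i) := by rw [warmUp]; push_cast; ring
      calc 48 * (b / warmUp (T i)) * U ≤ 48 * (b / warmUp (T i)) * (4 * sqrtSize (T i)) := by gcongr
        _ = b := by rw [hwm]; field_simp; norm_num
    have h5 : b ≤ b * (t / warmUp (T i)) :=
      le_mul_of_one_le_right (by linarith) ((one_le_div (by linarith)).2 hwt)
    have h6 : 0 ≤ b / warmUp (T i) := by positivity
    rw [h3] at h1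
    have h7 : 48 * (b * (t / warmUp (T i)) + b / warmUp (T i)) * U =
      48 * (b * (t / warmUp (T i))) * U + 48 * (b / warmUp (T i)) * U := by ring
    rw [h7] at h1
    linarith

/-- Each remaining run is charged its full initial value. A collision leaves at most this charge,
since a cross collision even ends the search. -/
theorem isPotential_cost (T : Fin 2 → SearchTree) (i : Fin 2) :
    IsPotential T 1 0 fun r t K => r * runCost (T i) 0 ∅ + runCost (T i) t K where
  step_nonneg := zero_le_one
  none_nonneg := le_rfl
  nonneg r t K := add_nonneg (mul_nonneg (by positivity) (runCost_nonneg ..)) (runCost_nonneg ..)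
  sample_le r t L := by
    have hend : endValue 0 (fun r t K => r * runCost (T i) 0 ∅ + runCost (T i) t K) r =
        r * runCost (T i) 0 ∅ := by
      cases r with
      | zero => simp [endValue]
      | succ r => simp only [endValue]; push_cast; ring
    have hnn : 0 ≤ r * runCost (T i) 0 ∅ := mul_nonneg (by positivity) (runCost_nonneg ..)
    have hle (s : Fin 2) : (T s).walkMean (outcomeValue 0
        (fun r t K => r * runCost (T i) 0 ∅ + runCost (T i) t K) (r, t, L) s) (walkBound t) ≤
        r * runCost (T i) 0 ∅ +
          (T s).walkMean (sampleValue (T i) t (seenColors L)) (walkBound t) := by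
      rw [← walkMean_const (r * runCost (T i) 0 ∅) (T s) (walkBound t), ← walkMean_add]
      refine walkMean_mono (fun o => ?_) _ _
      rcases o with _ | c
      · rfl
      · rcases hc : lookup L c with _ | u
        · simp only [outcomeValue, hc, sampleValue, if_neg (lookup_eq_none_iff.1 hc)]
          rfl
        · have : c ∈ seenColors L := by
            by_contra h
            rw [lookup_eq_none_iff.2 h] at hc
            cases hc
          simp only [outcomeValue, hc, sampleValue, if_pos this, hend]
          split_ifs <;> linarith
    have h0 := hle 0
    have h1 := hle 1
    have h2 := runCost_sample_le T i t (seenColors L)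
    rw [Fin.sum_univ_two] at h2 ⊢
    linarith
  roots_le r := by
    have hnn : 0 ≤ r * runCost (T i) 0 ∅ + runCost (T i) 0 ∅ :=
      add_nonneg (mul_nonneg (by positivity) (runCost_nonneg ..)) (runCost_nonneg ..)
    rcases (T 0).rootInfo with c | d <;> rcases (T 1).rootInfo with c' | d' <;>
      simp only [checkRoots]
    · split_ifs <;> exact hnn
    · exact hnn
    · exact hnn
    · rfl

theorem runCost_le (hS : 3 ≤ S.size) :
    runCost S 0 ∅ ≤ 70656 * (Real.logb 2 √(S.size : ℝ) * √(S.size : ℝ)) := by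
  have hS' : (3 : ℝ) ≤ S.size := by exact_mod_cast hS
  set x := √(S.size : ℝ) with hx
  have hx1 : √2 ≤ x := Real.sqrt_le_sqrt (by linarith)
  have hx2 : 1 ≤ x := Real.one_le_sqrt.2 (by linarith)
  have hl : 1 / 2 ≤ Real.logb 2 x := by
    rw [Real.le_logb_iff_rpow_le one_lt_two (by linarith), ← Real.sqrt_eq_rpow]
    exact hx1
  have hm : (warmUp S : ℝ) ≤ 384 * x := by
    have : (sqrtSize S : ℝ) < x + 1 := Nat.ceil_lt_add_one (by positivity)
    rw [warmUp]
    push_cast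
    linarith
  have hw : (1 : ℝ) ≤ warmUp S := by exact_mod_cast one_le_warmUp S
  -- From `384 ≤ 2 ^ 9` one gets `8 + 4 * (9 + logb 2 x)`, and `44 ≤ 88 * logb 2 x`.
  have hb : sampleCost S ≤ 92 * Real.logb 2 x := by
    have h1 : Real.logb 2 (warmUp S) ≤ Real.logb 2 (2 ^ (9 : ℝ) * x) :=
      Real.logb_le_logb_of_le one_lt_two (by linarith) (hm.trans (by norm_num; linarith))
    rw [Real.logb_mul (by positivity) (by positivity), Real.logb_rpow two_pos (by norm_num)] at h1
    rw [sampleCost]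
    linarith
  rw [runCost_zero]
  calc 2 * warmUp S * sampleCost S ≤ 2 * (384 * x) * (92 * Real.logb 2 x) := by
        have := eight_le_sampleCost S
        gcongr
    _ = _ := by ring

end Cost

end CollisionSearch

/-! ### The guarantees of the algorithm. -/

namespace CollisionSearch

open SearchTree ExplorationAlgorithm

variable {T : Fin 2 → SearchTree}

/-- The cost potential with its unit charge spent on steps instead of explored nodes; it holds for
all inputs, invariant or not. -/
theorem tendsto_activeProb_algorithm (T : Fin 2 → SearchTree) (ε : ℝ) :
    Filter.Tendsto (activeProb algorithm T ε) Filter.atTop (nhds 0) := by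
  classical
  refine tendsto_activeProb ENNReal.ofReal_ne_top fun n => le_trans (le_of_eq ?_)
    (le_add_self.trans
      ((isPotential_cost T 0).runMean_le le_rfl zero_le_one (by norm_num) ε n))
  refine Finset.sum_congr rfl fun j _ => ?_
  rw [activeProb]
  congr 1
  funext c
  split_ifs <;> simp

theorem Consistent.isMatch {c : algorithm.Config} (hc : Consistent T c) {p q : List ℕ}
    (h : algorithm.act c.mem = .inr (.inr (some (p, q)))) : IsMatch T p q := by
  obtain ⟨m, X⟩ := c
  rcases m with a | _ | _ | _ | _ <;>
    simp only [algorithm, action, reduceCtorEq, Sum.inr.injEq] at h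
  exact hc.2 p q h

theorem answerProb_eq_one {ε : ℝ} {S : Set Answer}
    (h : ∀ c r, Consistent T c → algorithm.act c.mem = .inr (.inr r) → r ∈ S) :
    algorithm.answerProb T ε S = 1 := by
  classical
  refine le_antisymm (answerProb_le_one ε S) ?_
  have := one_le_answerProb_add (S := S) (δ := 0) (tendsto_activeProb_algorithm T ε) fun n => ?_
  · rwa [add_zero] at this
  · refine (runMean_mono_of_support (h := fun _ => 0) fun c hc => ?_).trans (by simp [runMean])
    rw [if_neg]
    rintro ⟨r, hr, hact⟩
    exact hr (h c r (isInvariant_consistent.of_mem_support (consistent_initial ε) hc) hact)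

theorem answerProb_not_isMatch (T : Fin 2 → SearchTree) (ε : ℝ) :
    algorithm.answerProb T ε {r | ∃ p q, r = some (p, q) ∧ ¬ IsMatch T p q} = 0 := by
  classical
  refine nonpos_iff_eq_zero.1 (iSup_le fun n => ?_)
  rw [toOuterMeasure_run_eq]
  refine (runMean_mono_of_support (h := fun _ => 0) fun c hc => ?_).trans (by simp [runMean])
  rw [if_neg]
  rintro ⟨r, ⟨p, q, rfl, hpq⟩, hact⟩
  exact hpq ((isInvariant_consistent.of_mem_support (consistent_initial ε) hc).isMatch hact)

theorem answerProb_none (ε : ℝ) (h : ¬ ∃ p q, IsMatch T p q) :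
    algorithm.answerProb T ε {none} = 1 := by
  refine answerProb_eq_one fun c r hc hact => ?_
  rcases r with _ | ⟨p, q⟩
  · rfl
  · exact absurd ⟨p, q, hc.isMatch hact⟩ h

theorem half_pow_le {ε : ℝ} (hε : 0 < ε) : (1 / 2 : ℝ) ^ ⌈Real.logb 2 (1 / ε)⌉₊ ≤ ε := by
  have h : (1 / ε) ≤ 2 ^ (⌈Real.logb 2 (1 / ε)⌉₊ : ℝ) :=
    (Real.logb_le_iff_le_rpow one_lt_two (by positivity)).1 (Nat.le_ceil _)
  rw [Real.rpow_natCast] at h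
  rw [one_div_pow]
  exact (one_div_le (by positivity) hε).2 h

theorem le_answerProb_isSolution (hT : ∀ i j : Fin 2, (T i).CompleteInvariance (T j)) {ε : ℝ}
    (hε : 0 < ε) : ENNReal.ofReal (1 - ε) ≤ algorithm.answerProb T ε {r | IsSolution T r} := by
  classical
  by_cases h : ∃ p q, IsMatch T p q
  · obtain ⟨p, q, c, hp, hq⟩ := id h
    obtain ⟨φ, hφ, -⟩ := hT 0 1 ⟨p, by rw [hp]; rfl⟩ ⟨q, by rw [hq]; rfl⟩ c hp hq
    obtain ⟨ψ, hψ, -⟩ := hT 1 0 ⟨q, by rw [hq]; rfl⟩ ⟨p, by rw [hp]; rfl⟩ c hq hp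
    have hP := isPotential_failure hφ hψ
    have hinit : potential T 0 1 (fun r _ _ => (1 / 2) ^ (r + 1)) (algorithm.initial ε).mem ≤ ε := by
      refine le_trans (le_of_eq ?_) (half_pow_le hε)
      simp only [initial, algorithm]
      cases ⌈Real.logb 2 (1 / ε)⌉₊ <;> simp [potential]
    rw [ENNReal.ofReal_sub _ hε.le, ENNReal.ofReal_one, tsub_le_iff_right]
    refine one_le_answerProb_add (tendsto_activeProb_algorithm T ε) fun n => ?_
    -- The only incorrect final answer is `none`, whose failure potential is 1, so the potential
    -- dominates the indicator of an error.
    refine (runMean_mono_of_support fun c hc => ?_).trans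
      ((le_self_add.trans (hP.runMean_le le_rfl le_rfl (by norm_num) ε n)).trans
        (ENNReal.ofReal_le_ofReal hinit))
    split_ifs with hr
    · obtain ⟨r, hr, hact⟩ := hr
      have hcons : Consistent T c :=
        isInvariant_consistent.of_mem_support (consistent_initial ε) hc
      rcases r with _ | ⟨p, q⟩
      · obtain ⟨m, X⟩ := c
        rcases m with a | _ | _ | _ | _ <;>
          simp only [algorithm, action, reduceCtorEq, Sum.inr.injEq] at hact
        subst hact
        simp [potential]
      · exact absurd (hcons.isMatch hact) hr
    · exact zero_le
  · rw [answerProb_eq_one fun c r hc hact => ?_]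
    · exact ENNReal.ofReal_le_one.2 (by linarith)
    · rcases r with _ | ⟨p, q⟩
      · exact h
      · exact hc.isMatch hact

/-- No costs arise if a root is a leaf or if there are no runs. -/
theorem expectedCost_eq_zero {ε : ℝ} (h : ⌈Real.logb 2 (1 / ε)⌉₊ = 0 ∨
    ¬ ∃ d d', (T 0).rootInfo = .inr d ∧ (T 1).rootInfo = .inr d') :
    algorithm.expectedCost T ε = 0 := by
  let Inv (c : algorithm.Config) : Prop := Consistent T c ∧ c.explored = {(0, []), (1, [])} ∧
    ((∃ a, c.mem = Memory.halt a) ∨ (∃ r o, c.mem = Memory.check r o) ∧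
      ¬ ∃ d d', (T 0).rootInfo = .inr d ∧ (T 1).rootInfo = .inr d')
  have hInv : IsInvariant algorithm T Inv := by
    refine ⟨?_, ?_⟩
    · rintro ⟨m, X⟩ s p ⟨hc, hX, hm⟩ hact
      refine ⟨isInvariant_consistent.1 _ _ _ hc hact, ?_⟩
      dsimp only at hm hX
      rcases hm with ⟨a, rfl⟩ | ⟨⟨r, o, rfl⟩, hroot⟩
      · simp [algorithm, action] at hact
      · simp only [algorithm, action, Sum.inl.injEq] at hact
        cases hact
        rw [request_eq (hc.1 _) (subtreeAt_nil _)]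
        refine ⟨?_, ?_⟩
        · rcases o with _ | i <;> simp [hX]
        · rcases o with _ | i
          · exact .inr ⟨⟨_, _, rfl⟩, hroot⟩
          · obtain rfl : i = (T 0).rootInfo := hc.2 i rfl
            refine .inl ?_
            change ∃ a, checkRoots r (T 0).rootInfo (T 1).rootInfo = _
            rcases h0 : (T 0).rootInfo with c | d <;> rcases h1 : (T 1).rootInfo with c' | d' <;>
              simp only [checkRoots]
            · split_ifs <;> exact ⟨_, rfl⟩
            · exact ⟨_, rfl⟩
            · exact ⟨_, rfl⟩
            · exact absurd ⟨d, d', h0, h1⟩ hroot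
    · rintro ⟨m, X⟩ n ⟨hc, hX, hm⟩ hact
      dsimp only at hm
      rcases hm with ⟨a, rfl⟩ | ⟨⟨r, o, rfl⟩, -⟩ <;> simp [algorithm, action] at hact
  have h0 : Inv (algorithm.initial ε) := by
    refine ⟨consistent_initial ε, rfl, ?_⟩
    simp only [initial, algorithm]
    rcases h with h | h
    · exact .inl ⟨none, by rw [h]; rfl⟩
    · cases ⌈Real.logb 2 (1 / ε)⌉₊
      exacts [.inl ⟨_, rfl⟩, .inr ⟨⟨_, _, rfl⟩, h⟩]
  refine nonpos_iff_eq_zero.1 (iSup_le fun n => ?_)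
  refine (runMean_mono_of_support (h := fun _ => 0) fun c hc => ?_).trans (by simp [runMean])
  have hX := (hInv.of_mem_support h0 hc).2.1
  simp [Config.cost, hX, Finset.filter_insert, Finset.filter_singleton]

theorem expectedCost_le (T : Fin 2 → SearchTree) (i : Fin 2) (ε : ℝ)
    (hsize : 3 ≤ (T i).size) :
    algorithm.expectedCost T ε ≤ ENNReal.ofReal (80000 * (⌈Real.logb 2 (1 / ε)⌉₊ : ℝ) *
      Real.logb 2 √((T i).size : ℝ) * √((T i).size : ℝ)) := by
  refine iSup_le fun n => ?_
  have hP := isPotential_cost T i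
  refine (runMean_mono_of_support fun c _ => ?_).trans
    ((le_self_add.trans (hP.runMean_le zero_le_one le_rfl (by norm_num) ε n)).trans
      (ENNReal.ofReal_le_ofReal ?_))
  · rw [one_mul, ← ENNReal.ofReal_natCast]
    exact ENNReal.ofReal_le_ofReal (le_add_of_nonneg_right (hP.potential_nonneg _))
  · simp only [initial, algorithm]
    cases ⌈Real.logb 2 (1 / ε)⌉₊ with
    | zero => simp [potential]
    | succ r =>
      have hS' : (3 : ℝ) ≤ (T i).size := by exact_mod_cast hsize
      have hV := runCost_le (T i) hsize
      set x := √((T i).size : ℝ) with hx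
      have hx1 : √2 ≤ x := Real.sqrt_le_sqrt (by linarith)
      have hx2 : 1 ≤ x := Real.one_le_sqrt.2 (by linarith)
      have hl : 1 / 2 ≤ Real.logb 2 x := by
        rw [Real.le_logb_iff_rpow_le one_lt_two (by linarith), ← Real.sqrt_eq_rpow]
        exact hx1
      have hlx : 1 / 2 ≤ Real.logb 2 x * x := by nlinarith
      simp only [potential, Option.elim_none]
      push_cast
      have h1 : (r + 1 : ℝ) * runCost (T i) 0 ∅ ≤
          (r + 1) * (70656 * (Real.logb 2 x * x)) := by gcongr
      -- The two requests for the roots add 2, which `hlx` absorbs into the gap between 70656 and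
      -- 80000.
      nlinarith [mul_nonneg (Nat.cast_nonneg (α := ℝ) r) (by linarith : 0 ≤ Real.logb 2 x * x)]

theorem expectedCost_algorithm_le (T : Fin 2 → SearchTree) (ε : ℝ) :
    algorithm.expectedCost T ε ≤ ENNReal.ofReal (80000 * (⌈Real.logb 2 (1 / ε)⌉₊ : ℝ) *
      Real.logb 2 (min √((T 0).size : ℝ) √((T 1).size : ℝ)) *
        min √((T 0).size : ℝ) √((T 1).size : ℝ)) := by
  by_cases h : ∃ d d', (T 0).rootInfo = .inr d ∧ (T 1).rootInfo = .inr d'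
  · have hsize (i : Fin 2) : 3 ≤ (T i).size := by
      obtain ⟨d, d', h0, h1⟩ := h
      rcases hi : T i with c | ⟨k, child⟩
      · obtain rfl | rfl : i = 0 ∨ i = 1 := by omega
        · simp [hi, rootInfo] at h0
        · simp [hi, rootInfo] at h1
      · exact three_le_size_node k child
    rcases min_choice √((T 0).size : ℝ) √((T 1).size : ℝ) with h' | h' <;> rw [h']
    exacts [expectedCost_le T 0 ε (hsize 0), expectedCost_le T 1 ε (hsize 1)]
  -- A tree with one node makes the logarithm, and so the whole bound, equal to 0; the cost must
  -- vanish exactly.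
  · rw [expectedCost_eq_zero (.inr h)]
    exact zero_le

end CollisionSearch

theorem mainTheorem1 :
    ∃ C : ℝ, 0 < C ∧ ∃ A : ExplorationAlgorithm,
      ∀ ε : ℝ, 0 < ε → ε ≤ 1 → ∀ T : Fin 2 → SearchTree,
        (∀ i j : Fin 2, (T i).CompleteInvariance (T j)) →
          A.answerProb T ε Set.univ = 1 ∧
          ENNReal.ofReal (1 - ε) ≤ A.answerProb T ε {r | IsSolution T r} ∧
          A.answerProb T ε {r | ∃ p q, r = some (p, q) ∧ ¬ IsMatch T p q} = 0 ∧
          ((¬ ∃ p q, IsMatch T p q) → A.answerProb T ε {none} = 1) ∧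
          A.expectedCost T ε ≤ ENNReal.ofReal
            (C * (⌈Real.logb 2 (1 / ε)⌉₊ : ℝ) *
              Real.logb 2 (min (√((T 0).size : ℝ)) (√((T 1).size : ℝ))) *
                min (√((T 0).size : ℝ)) (√((T 1).size : ℝ))) := by
  refine ⟨80000, by norm_num, CollisionSearch.algorithm, fun ε hε _ T hT => ⟨?_, ?_, ?_, ?_, ?_⟩⟩
  · exact CollisionSearch.answerProb_eq_one fun _ _ _ _ => Set.mem_univ _
  · exact CollisionSearch.le_answerProb_isSolution hT hε
  · exact CollisionSearch.answerProb_not_isMatch T ε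
  · exact CollisionSearch.answerProb_none ε
  · exact CollisionSearch.expectedCost_algorithm_le T ε
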